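/- Theorem 1 (Borel--Pompeiu). Let $\mu>0$, $\lambda>-\tfrac{2\mu}{3}$, and put $\alpha=\frac{\mu+\lambda}{2}$, $\beta=\frac{3\mu+\lambda}{2}$, $\alpha^{*}=\frac{\alpha}{\alpha^2-\beta^2}$, $\beta^{*}=\frac{\beta}{\alpha^2-\beta^2}$. Write $\partial_{z}=\frac12(\partial_x-i\partial_y)$, $\partial_{\bar z}=\frac12(\partial_x+i\partial_y)$ and $$\mathcal L_{\alpha,\beta}[f]=\alpha\,\partial_{\bar z}\partial_{\bar z}\bar f+\beta\,\partial_{\bar z}\partial_{z}f .$$ Let $\Omega\subset\mathbb C$ be a bounded simply connected domain whose boundary $\gamma$ is a positively oriented smooth closed Jordan curve (smooth: with a $C^1$ parametrization whose derivative never vanishes), and let $f\in C^2(\Omega)\cap C^1(\overline\Omega)$ be complex valued. Then for every $z\in\Omega$ $$f(z)=-\frac{\alpha\alpha^{*}}{2\pi i}\int_\gamma\frac{f(\xi)}{\overline{\xi-z}}\,\overline{d\xi}-\frac{\beta\beta^{*}}{2\pi i}\int_\gamma\frac{f(\xi)}{\xi-z}\,d\xi+\frac{\alpha^{*}}{2\pi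 i}\int_{\gamma}\frac{\xi-z}{\overline{\xi-z}}\Big[\alpha\,\partial_{\xi}f\,\overline{d\xi}+\beta\,\partial_{\bar\xi}\bar f\,\overline{d\xi}\Big]$$ $$+\frac{\beta^{*}}{2\pi i}\int_{\gamma}\ln|\xi-z|^2\Big[\alpha\,\partial_{\bar\xi}\bar f\,d\xi-\beta\,\partial_{\bar\xi}f\,\overline{d\xi}\Big]+\frac1\pi\int_\Omega\Big[\alpha^{*}\frac{\xi-z}{\overline{\xi-z}}\,\overline{\mathcal L_{\alpha,\beta}[f](\xi)}-\beta^{*}\ln|\xi-z|^2\,\mathcal L_{\alpha,\beta}[f](\xi)\Big]dA(\xi),$$ where $dA$ is Lebesgue measure on the plane, and the first derivatives of $f$ on $\gamma$ are the continuous extensions of those in $\Omega$. The domain integral is the limit, as $\varepsilon\to0^{+}$, of the absolutely convergent integrals over $\{\xi\in\Omega:\operatorname{dist}(\xi,\gamma)>\varepsilon\}$; it is the ordinary Lebesgue integral over $\Omega$ whenever its integrand is integrable on $\Omega$. -/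

import Mathlib

open Set Filter Topology MeasureTheory
open scoped ComplexConjugate

noncomputable section

namespace LameNavier

/-- The Wirtinger derivative `∂_z = (∂_x - i ∂_y) / 2`. -/
def dz (f : ℂ → ℂ) (z : ℂ) : ℂ :=
  (fderiv ℝ f z 1 - Complex.I * fderiv ℝ f z Complex.I) / 2

/-- The Cauchy-Riemann operator `∂_z̄ = (∂_x + i ∂_y) / 2`. -/
def dzbar (f : ℂ → ℂ) (z : ℂ) : ℂ :=
  (fderiv ℝ f z 1 + Complex.I * fderiv ℝ f z Complex.I) / 2

/-- The complex conjugate function `f̄`. -/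
def conjFun (f : ℂ → ℂ) (z : ℂ) : ℂ := conj (f z)

/-- The Lamé-Navier operator `L[f] = α ∂_z̄ ∂_z̄ f̄ + β ∂_z̄ ∂_z f`. -/
def lame (α β : ℝ) (f : ℂ → ℂ) (z : ℂ) : ℂ :=
  (α : ℂ) * dzbar (dzbar (conjFun f)) z + (β : ℂ) * dzbar (dz f) z

/-- `α* = α / (α² - β²)`. -/
def alphaStar (α β : ℝ) : ℝ := α / (α ^ 2 - β ^ 2)

/-- `β* = β / (α² - β²)`. -/
def betaStar (α β : ℝ) : ℝ := β / (α ^ 2 - β ^ 2)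

/-- `γ` is a regular `C¹` parametrization, of period `1`, of a closed Jordan curve which is the
boundary of `Ω`, and it is positively oriented: `Ω` lies to the left of `γ`. -/
structure IsSmoothJordanBoundary (Ω : Set ℂ) (γ : ℝ → ℂ) : Prop where
  contDiff : ContDiff ℝ 1 γ
  periodic : Function.Periodic γ 1
  injOn : InjOn γ (Ico 0 1)
  deriv_ne_zero : ∀ t, deriv γ t ≠ 0
  frontier_eq : frontier Ω = range γ
  left : ∀ t, ∀ᶠ s : ℝ in 𝓝[>] 0, γ t + (s : ℂ) * (Complex.I * deriv γ t) ∈ Ω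

/-- `f ∈ C¹(closure Ω)`: `f` is `C¹` in `Ω`, continuous on the closure of `Ω`, and the first
derivative of `f` in `Ω` extends continuously to the closure of `Ω`. -/
def IsC1UpToBoundary (Ω : Set ℂ) (f : ℂ → ℂ) : Prop :=
  ContDiffOn ℝ 1 f Ω ∧ ContinuousOn f (closure Ω) ∧
    ∃ D : ℂ → (ℂ →L[ℝ] ℂ), ContinuousOn D (closure Ω) ∧ EqOn D (fderiv ℝ f) Ω

/-- The contour integral `∫_γ [a(ξ) dξ + b(ξ) dξ̄]`. -/
def formIntegral (γ : ℝ → ℂ) (a b : ℂ → ℂ) : ℂ :=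
  ∫ t in (0 : ℝ)..1, (a (γ t) * deriv γ t + b (γ t) * conj (deriv γ t))

/-- The kernel `(ξ - z) / conj (ξ - z)`. -/
def quotKernel (z ξ : ℂ) : ℂ := (ξ - z) / conj (ξ - z)

/-- The kernel `ln |ξ - z|²`. -/
def logKernel (z ξ : ℂ) : ℂ := ((Real.log (‖ξ - z‖ ^ 2) : ℝ) : ℂ)

/-- The sum of the boundary integrals. The first derivatives of `f` on `γ` are the limits of
their values in `Ω`, i.e. `extendFrom Ω`. -/
def boundaryPart (α β : ℝ) (Ω : Set ℂ) (γ : ℝ → ℂ) (f : ℂ → ℂ) (z : ℂ) : ℂ :=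
  -((α * alphaStar α β : ℝ) : ℂ) / (2 * Real.pi * Complex.I) *
      formIntegral γ (fun _ => 0) (fun ξ => f ξ / conj (ξ - z))
  - ((β * betaStar α β : ℝ) : ℂ) / (2 * Real.pi * Complex.I) *
      formIntegral γ (fun ξ => f ξ / (ξ - z)) (fun _ => 0)
  + (alphaStar α β : ℂ) / (2 * Real.pi * Complex.I) *
      formIntegral γ (fun _ => 0) (fun ξ => quotKernel z ξ *
        ((α : ℂ) * extendFrom Ω (dz f) ξ + (β : ℂ) * extendFrom Ω (dzbar (conjFun f)) ξ))
  + (betaStar α β : ℂ) / (2 * Real.pi * Complex.I) *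
      formIntegral γ
        (fun ξ => logKernel z ξ * ((α : ℂ) * extendFrom Ω (dzbar (conjFun f)) ξ))
        (fun ξ => -(logKernel z ξ * ((β : ℂ) * extendFrom Ω (dzbar f) ξ)))

/-- The integrand of the domain integral. -/
def domainIntegrand (α β : ℝ) (f : ℂ → ℂ) (z ξ : ℂ) : ℂ :=
  (alphaStar α β : ℂ) * quotKernel z ξ * conj (lame α β f ξ)
    - (betaStar α β : ℂ) * logKernel z ξ * lame α β f ξ

/-- The points of `Ω` at distance more than `ε` from the boundary of `Ω`. -/
def innerPart (Ω : Set ℂ) (ε : ℝ) : Set ℂ :=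
  {ξ | ξ ∈ Ω ∧ ε < Metric.infDist ξ (frontier Ω)}

end LameNavier

end

/-!
The formula is an integration by parts whose singular terms are collected by the Cauchy-Pompeiu
formula. Write `K = (ξ - z) / conj (ξ - z)` and `ℓ = ln |ξ - z|²`. Since `∂K = ∂_z̄ ℓ = 1 / conj (ξ - z)`
and `∂ℓ = 1 / (ξ - z)`, off the point `z` the domain integrand equals
`α* ∂(K (α ∂f + β ∂_z̄ f̄)) - β* ∂_z̄ (ℓ α ∂_z̄ f̄) - β* ∂(ℓ β ∂_z̄ f)` plus
`-α α* ∂f / conj (ξ - z) + β β* ∂_z̄ f / (ξ - z)`; the mixed terms cancel because `α* β = β* α`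
(`domainIntegrand_eq`). The divergence theorem turns the first three terms into boundary integrals,
and the Cauchy-Pompeiu formula and its conjugate evaluate the other two, which leaves the factor
`α α* - β β* = 1` in front of `f z` (`borelPompeiu`).

The main work is the divergence theorem (`hasFlux`): for `g` continuous on the closure of `Ω` and `C¹`
in `Ω`, with no control of its derivatives at the boundary, the integrals of `∂_v g` over
`Ω_ε = innerPart Ω ε` converge to the flux of `g v` through `γ`. The curve is only `C¹`, so the boundary
of `Ω_ε` need not be a curve with a tangent, and no parametrization of it is used. Instead, let `e` be a
unit vector that points to the left of `γ` near `γ t₀`. There the coordinates `γ t + u e` describe `Ω` as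
`u > 0` (`IsSmoothJordanBoundary.exists_chart`), so that moving in the direction `e` does not leave `Ω`;
translating nearest boundary points shows the same for `Ω_ε` (`add_mem_innerPart`). Hence a line in the
direction `e` meets `Ω_ε` in a ray, and if `g` is supported near `γ t₀` then the integral of `∂_e g`
over this ray is minus the value of `g` at its end point (`integral_slice`), which tends to the boundary
value. Integrating over the lines, by Fubini and dominated convergence, gives the theorem in the
direction `e` (`exists_hasFlux_of_unit`). Every direction is a combination of two directions to the left
of the curve (`exists_hasFlux`), and finitely many cutoff functions localize a general `g`.

That `Ω` lies on one side of `γ` only is proved without the Jordan curve theorem: if `Ω` were on both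
sides at one point, it would be on both sides everywhere by connectedness of the parameter line, and the
closure of `Ω` would be open, which is impossible for a bounded set
(`IsSmoothJordanBoundary.notMem_interior_closure`).

The kernels `K` and `ℓ` have derivatives `O(1 / |ξ - z|)`, hence integrable ones, and almost every line
in a given direction avoids `z`, so that the divergence theorem extends to them
(`satisfiesStokes_of_singular`). For the Cauchy kernel, the contribution of the singular point is
computed in polar coordinates (`integral_dzbar_div_self`).
-/

namespace LameNavier

variable {Ω : Set ℂ} {γ : ℝ → ℂ}

/-! ### The oriented area -/

/-- The oriented area `a × b` of the parallelogram spanned by two plane vectors, which is positive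
when `b` points to the left of `a`. -/
def cross (a b : ℂ) : ℝ := a.re * b.im - a.im * b.re

lemma cross_add_right (a b c : ℂ) : cross a (b + c) = cross a b + cross a c := by
  simp only [cross, Complex.add_re, Complex.add_im]; ring

lemma cross_smul_right (a b : ℂ) (s : ℝ) : cross a ((s : ℂ) * b) = s * cross a b := by
  simp [cross]; ring

lemma cross_I_mul_self (a : ℂ) : cross a (Complex.I * a) = ‖a‖ ^ 2 := by
  rw [← Complex.normSq_eq_norm_sq, Complex.normSq_apply]; simp [cross]

/-- `cross · e` as a continuous linear form. -/
noncomputable def crossL (e : ℂ) : ℂ →L[ℝ] ℝ := e.im • Complex.reCLM - e.re • Complex.imCLM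

@[simp] lemma crossL_apply (e a : ℂ) : crossL e a = cross a e := by
  simp [crossL, cross]; ring

lemma continuous_cross (e : ℂ) : Continuous fun a => cross a e := by
  unfold cross; fun_prop

/-- A vector with zero cross product against a unit vector `e` is a real multiple of `e`. -/
lemma exists_eq_mul_of_cross_eq_zero {e w : ℂ} (he : ‖e‖ = 1) (h : cross w e = 0) :
    ∃ u : ℝ, w = (u : ℂ) * e := by
  have h1 : e.re * e.re + e.im * e.im = 1 := by
    rw [← Complex.normSq_apply, Complex.normSq_eq_norm_sq, he]; norm_num
  unfold cross at h
  refine ⟨w.re * e.re + w.im * e.im, Complex.ext ?_ ?_⟩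
  · simp; linear_combination -w.re * h1 + e.im * h
  · simp; linear_combination -w.im * h1 - e.re * h

lemma norm_ofReal_mul_unit {e : ℂ} (he : ‖e‖ = 1) (u : ℝ) : ‖(u : ℂ) * e‖ = |u| := by
  rw [norm_mul, he, mul_one, Complex.norm_real, Real.norm_eq_abs]

lemma subset_of_disjoint_frontier {X : Type*} [TopologicalSpace X] {s t : Set X}
    (hs : IsOpen s) (ht : IsPreconnected t)
    (hd : Disjoint t (frontier s)) (hne : (t ∩ s).Nonempty) : t ⊆ s := by
  refine ht.subset_left_of_subset_union hs isClosed_closure.isOpen_compl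
    (disjoint_compl_right.mono_left subset_closure) (fun x hx => ?_) hne
  by_contra hcon
  simp only [mem_union, mem_compl_iff, not_or, not_not] at hcon
  exact disjoint_left.1 hd hx (by rw [hs.frontier_eq]; exact ⟨hcon.2, hcon.1⟩)


/-! ### Local structure of the boundary curve -/

namespace IsSmoothJordanBoundary

lemma hasDerivAt (hγ : IsSmoothJordanBoundary Ω γ) (t : ℝ) : HasDerivAt γ (deriv γ t) t :=
  (hγ.contDiff.differentiable (by norm_num) t).hasDerivAt

lemma continuous (hγ : IsSmoothJordanBoundary Ω γ) : Continuous γ := hγ.contDiff.continuous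

lemma continuous_deriv (hγ : IsSmoothJordanBoundary Ω γ) : Continuous (deriv γ) :=
  hγ.contDiff.continuous_deriv (by norm_num)

lemma mem_frontier (hγ : IsSmoothJordanBoundary Ω γ) (t : ℝ) : γ t ∈ frontier Ω := by
  rw [hγ.frontier_eq]; exact mem_range_self t

lemma notMem (hγ : IsSmoothJordanBoundary Ω γ) (hΩ : IsOpen Ω) (t : ℝ) : γ t ∉ Ω := by
  have := hγ.mem_frontier t
  rw [hΩ.frontier_eq] at this
  exact this.2

lemma mem_closure (hγ : IsSmoothJordanBoundary Ω γ) (t : ℝ) : γ t ∈ closure Ω :=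
  frontier_subset_closure (hγ.mem_frontier t)

lemma apply_sub_int (hγ : IsSmoothJordanBoundary Ω γ) (x : ℝ) (n : ℤ) : γ (x - n) = γ x := by
  have := hγ.periodic.sub_int_mul_eq (x := x) n
  rwa [mul_one] at this

lemma exists_int_of_eq (hγ : IsSmoothJordanBoundary Ω γ) {a b : ℝ} (h : γ a = γ b) :
    ∃ n : ℤ, a = b + n := by
  have key : ∀ x : ℝ, γ (Int.fract x) = γ x := fun x => hγ.apply_sub_int x ⌊x⌋
  have h1 : Int.fract a = Int.fract b :=
    hγ.injOn ⟨Int.fract_nonneg a, Int.fract_lt_one a⟩ ⟨Int.fract_nonneg b, Int.fract_lt_one b⟩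
      (by rw [key, key, h])
  obtain ⟨n, hn⟩ := Int.fract_eq_fract.1 h1
  exact ⟨n, by linarith⟩

/-- Curve points close to `γ t₀` have parameters close to `t₀`, modulo the period. -/
lemma exists_param_near (hγ : IsSmoothJordanBoundary Ω γ) (t₀ : ℝ) {δ : ℝ} (hδ : 0 < δ) :
    ∃ r > 0, ∀ t, ‖γ t - γ t₀‖ < r → ∃ n : ℤ, |t - t₀ - n| < δ := by
  set K := Icc (t₀ + δ) (t₀ + 1 - δ)
  have hcl : IsClosed (γ '' K) := (isCompact_Icc.image hγ.continuous).isClosed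
  have hn : γ t₀ ∉ γ '' K := by
    rintro ⟨s, ⟨hs1, hs2⟩, hs⟩
    obtain ⟨n, hn⟩ := hγ.exists_int_of_eq hs
    have h1 : (0 : ℝ) < n := by linarith
    have h2 : (n : ℝ) < 1 := by linarith
    have h1' : 0 < n := by exact_mod_cast h1
    have h2' : n < 1 := by exact_mod_cast h2
    omega
  obtain ⟨r, hr, hball⟩ := Metric.isOpen_iff.1 hcl.isOpen_compl (γ t₀) hn
  refine ⟨r, hr, fun t ht => ?_⟩
  obtain ⟨s, hs, hst⟩ := hγ.periodic.exists_mem_Ico (by norm_num : (0 : ℝ) < 1) t (t₀ - δ)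
  obtain ⟨n, hn⟩ := hγ.exists_int_of_eq hst
  have hsK : s ∉ K := fun h => hball (by rwa [Metric.mem_ball, dist_eq_norm]) ⟨s, h, hst.symm⟩
  rcases lt_or_ge s (t₀ + δ) with h | h
  · rcases hs.1.eq_or_lt with h' | h'
    -- the left end of the period is congruent to `t₀ + 1 - δ`, which lies in `K` if `δ ≤ 1 / 2`
    · have h2 : γ t = γ (t₀ + 1 - δ) := by
        rw [hst, ← h', show t₀ + 1 - δ = t₀ - δ + 1 by ring, hγ.periodic]
      by_cases h3 : t₀ + δ ≤ t₀ + 1 - δ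
      · exact absurd ⟨t₀ + 1 - δ, ⟨h3, le_rfl⟩, h2.symm⟩
          (hball (by rwa [Metric.mem_ball, dist_eq_norm]))
      · refine ⟨n - 1, ?_⟩
        push_cast
        rw [abs_lt]; constructor <;> linarith
    · exact ⟨n, by rw [abs_lt]; constructor <;> linarith⟩
  · have h4 : t₀ + 1 - δ < s := by
      by_contra hcon
      exact hsK ⟨h, not_lt.1 hcon⟩
    refine ⟨n - 1, ?_⟩
    push_cast
    rw [abs_lt]; constructor <;> linarith [hs.2]

lemma exists_cross_pos (hγ : IsSmoothJordanBoundary Ω γ) {t₀ : ℝ} {e : ℂ}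
    (he : 0 < cross (deriv γ t₀) e) :
    ∃ δ > 0, ∀ t, |t - t₀| < δ → 0 < cross (deriv γ t) e := by
  have hc : Continuous fun t => cross (deriv γ t) e :=
    (continuous_cross e).comp hγ.continuous_deriv
  obtain ⟨δ, hδ, h⟩ := Metric.eventually_nhds_iff.1 (hc.continuousAt.eventually (lt_mem_nhds he))
  exact ⟨δ, hδ, fun t ht => h (by rwa [Real.dist_eq])⟩

lemma hasDerivAt_cross (hγ : IsSmoothJordanBoundary Ω γ) (e : ℂ) (t : ℝ) :
    HasDerivAt (fun t => cross (γ t) e) (cross (deriv γ t) e) t := by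
  have := (crossL e).hasFDerivAt.comp_hasDerivAt t (hγ.hasDerivAt t)
  simpa only [Function.comp_def, crossL_apply] using this

lemma strictMonoOn_cross (hγ : IsSmoothJordanBoundary Ω γ) {t₀ δ : ℝ} {e : ℂ}
    (h : ∀ t, |t - t₀| < δ → 0 < cross (deriv γ t) e) :
    StrictMonoOn (fun t => cross (γ t) e) (Metric.ball t₀ δ) := by
  refine strictMonoOn_of_deriv_pos (convex_ball _ _)
    (fun t _ => (hγ.hasDerivAt_cross e t).continuousAt.continuousWithinAt) fun t ht => ?_
  rw [(hγ.hasDerivAt_cross e t).deriv]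
  exact h t (by simpa [Real.dist_eq] using interior_subset ht)

/-- Near the base point, a curve point on the line through `γ t` with transversal direction `e` is
`γ t` itself. -/
lemma exists_eq_zero_of_eq_add (hγ : IsSmoothJordanBoundary Ω γ) {t₀ δ : ℝ}
    (hδ : 0 < δ) :
    ∃ r > 0, ∀ e : ℂ, e ≠ 0 → (∀ t, |t - t₀| < δ → 0 < cross (deriv γ t) e) →
      ∀ t t' u : ℝ, |t - t₀| < δ →
      γ t' = γ t + u * e → ‖γ t' - γ t₀‖ < r → u = 0 := by
  obtain ⟨r, hr, h⟩ := hγ.exists_param_near t₀ hδ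
  refine ⟨r, hr, fun e he0 he t t' u ht heq hlt => ?_⟩
  obtain ⟨n, hn⟩ := h t' hlt
  have h1 : γ (t' - n) = γ t' := hγ.apply_sub_int t' n
  rw [← h1] at heq
  have h2 : cross (γ (t' - n)) e = cross (γ t) e := by
    rw [heq]; simp [cross]; ring
  have h3 : t' - n = t := (hγ.strictMonoOn_cross he).injOn
    (by rw [Metric.mem_ball, Real.dist_eq]; convert hn using 2; ring)
    (by rwa [Metric.mem_ball, Real.dist_eq]) h2
  rw [h3] at heq
  have h4 : (u : ℂ) * e = 0 := by linear_combination -heq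
  simpa [he0] using h4

/-- All directions `e` on the left of `γ` at `γ t` point into `Ω`: the triangle spanned by `e` and
the normal does not meet the curve near `γ t`. -/
lemma eventually_mem_of_cross_pos (hγ : IsSmoothJordanBoundary Ω γ) (hΩ : IsOpen Ω)
    {t : ℝ} {e : ℂ} (he : 0 < cross (deriv γ t) e) :
    ∀ᶠ s : ℝ in 𝓝[>] 0, γ t + s * e ∈ Ω := by
  set n := Complex.I * deriv γ t with hn
  have hnpos : 0 < cross (deriv γ t) n := by
    rw [hn, cross_I_mul_self]
    have := norm_pos_iff.2 (hγ.deriv_ne_zero t)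
    positivity
  obtain ⟨δ₁, hδ₁, h₁⟩ := hγ.exists_cross_pos he
  obtain ⟨δ₂, hδ₂, h₂⟩ := hγ.exists_cross_pos hnpos
  obtain ⟨r, hr, h⟩ := hγ.exists_eq_zero_of_eq_add (t₀ := t) (lt_min hδ₁ hδ₂)
  have hsmall : ∀ᶠ s : ℝ in 𝓝[>] 0, s * (‖n‖ + ‖e‖) < r := by
    have : Tendsto (fun s : ℝ => s * (‖n‖ + ‖e‖)) (𝓝[>] 0) (𝓝 0) := by
      have : Continuous (fun s : ℝ => s * (‖n‖ + ‖e‖)) := by fun_prop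
      simpa using (this.tendsto 0).mono_left nhdsWithin_le_nhds
    exact this.eventually (gt_mem_nhds hr)
  filter_upwards [hγ.left t, hsmall, self_mem_nhdsWithin] with s hs hs2 hs0
  have hs0 : 0 < s := hs0
  set F : ℝ → ℂ := fun θ => γ t + s * ((1 - θ : ℝ) * n + θ * e)
  have hF : Continuous F := by fun_prop
  have hpre : IsPreconnected (F '' Icc 0 1) := isPreconnected_Icc.image _ hF.continuousOn
  have hd : Disjoint (F '' Icc 0 1) (frontier Ω) := by
    rw [disjoint_left]
    rintro _ ⟨θ, ⟨hθ0, hθ1⟩, rfl⟩ hmem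
    rw [hγ.frontier_eq] at hmem
    obtain ⟨t', ht'⟩ := hmem
    have hpos : ∀ t'', |t'' - t| < min δ₁ δ₂ →
        0 < cross (deriv γ t'') ((1 - θ : ℝ) * n + θ * e) := fun t'' ht'' => by
      have a1 := h₁ t'' (ht''.trans_le (min_le_left _ _))
      have a2 := h₂ t'' (ht''.trans_le (min_le_right _ _))
      rw [cross_add_right, cross_smul_right, cross_smul_right]
      rcases hθ0.eq_or_lt with h0 | h0
      · rw [← h0]; simpa using a2
      · have := mul_nonneg (sub_nonneg.2 hθ1) a2.le
        have := mul_pos h0 a1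
        linarith
    have hne : ((1 - θ : ℝ) : ℂ) * n + θ * e ≠ 0 := fun h0 => by
      have := hpos t (by simpa using lt_min hδ₁ hδ₂)
      rw [h0] at this
      simp [cross] at this
    have := h _ hne hpos t t' s (by simpa using lt_min hδ₁ hδ₂) ht' (by
      rw [ht']
      simp only [F, add_sub_cancel_left]
      refine lt_of_le_of_lt ?_ hs2
      rw [norm_mul, Complex.norm_real, Real.norm_eq_abs, abs_of_pos hs0]
      refine mul_le_mul_of_nonneg_left ((norm_add_le _ _).trans (add_le_add ?_ ?_)) hs0.le
      · rw [norm_mul, Complex.norm_real, Real.norm_eq_abs, abs_of_nonneg (by linarith)]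
        exact mul_le_of_le_one_left (norm_nonneg _) (by linarith)
      · rw [norm_mul, Complex.norm_real, Real.norm_eq_abs, abs_of_nonneg hθ0]
        exact mul_le_of_le_one_left (norm_nonneg _) hθ1)
    exact hs0.ne' this
  have hsub := subset_of_disjoint_frontier hΩ hpre hd
    ⟨F 0, ⟨0, by simp, rfl⟩, by simpa [F] using hs⟩
  have : F 1 ∈ Ω := hsub ⟨1, by simp, rfl⟩
  simpa [F] using this

/-- Near `γ t₀`, the points off the curve have coordinates `(t, u)`, standing for `γ t + u * e`, with
`u ≠ 0`. Each side `u > 0`, `u < 0` is connected and misses the boundary of `Ω`. -/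
lemma exists_coordinates (hγ : IsSmoothJordanBoundary Ω γ) {t₀ : ℝ} {e : ℂ} (hnorm : ‖e‖ = 1)
    (he : 0 < cross (deriv γ t₀) e) {δ₀ : ℝ} (hδ₀ : 0 < δ₀) :
    ∃ δ > 0, ∃ h > 0, ∃ ρ > 0, δ ≤ δ₀ ∧
      (∀ t, |t - t₀| < δ → 0 < cross (deriv γ t) e) ∧
      (∀ t u : ℝ, |t - t₀| < δ → |u| < h → u ≠ 0 → γ t + u * e ∉ frontier Ω) ∧
      (∀ p : ℂ, ‖p - γ t₀‖ < ρ → ∃ t u : ℝ, |t - t₀| < δ ∧ |u| < h ∧ p = γ t + u * e) := by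
  obtain ⟨δ₁, hδ₁, h₁⟩ := hγ.exists_cross_pos he
  have hm : 0 < min δ₀ δ₁ := lt_min hδ₀ hδ₁
  have hpos : ∀ t, |t - t₀| < min δ₀ δ₁ → 0 < cross (deriv γ t) e :=
    fun t ht => h₁ t (ht.trans_le (min_le_right _ _))
  obtain ⟨r, hr, hr'⟩ := hγ.exists_eq_zero_of_eq_add (t₀ := t₀) hm
  have he0 : e ≠ 0 := by rintro rfl; simp at hnorm
  obtain ⟨δ₂, hδ₂, h₂⟩ := Metric.continuousAt_iff.1 (hγ.continuous.continuousAt (x := t₀)) (r / 4)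
    (by positivity)
  simp only [dist_eq_norm] at h₂
  set δ := min (min δ₀ δ₁) δ₂ with hδdef
  have hδ : 0 < δ := lt_min hm hδ₂
  have hδle : δ ≤ min δ₀ δ₁ := min_le_left _ _
  -- the values of `cross (γ ·) e` at the ends of a smaller parameter interval
  set a := t₀ - δ / 2
  set b := t₀ + δ / 2
  have hsm := hγ.strictMonoOn_cross hpos
  have hmem : ∀ t, |t - t₀| < min δ₀ δ₁ → t ∈ Metric.ball t₀ (min δ₀ δ₁) := fun t ht => by
    rwa [Metric.mem_ball, Real.dist_eq]
  have ha : |a - t₀| < min δ₀ δ₁ := by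
    simp only [a]; rw [abs_lt]; constructor <;> linarith
  have hb : |b - t₀| < min δ₀ δ₁ := by
    simp only [b]; rw [abs_lt]; constructor <;> linarith
  have h0 : |t₀ - t₀| < min δ₀ δ₁ := by simpa using hm
  have hXa : cross (γ a) e < cross (γ t₀) e :=
    hsm (hmem _ ha) (hmem _ h0) (by simp only [a]; linarith)
  have hXb : cross (γ t₀) e < cross (γ b) e :=
    hsm (hmem _ h0) (hmem _ hb) (by simp only [b]; linarith)
  have hcont : ContinuousAt (fun p : ℂ => cross p e) (γ t₀) :=
    (continuous_cross e).continuousAt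
  obtain ⟨ρ₁, hρ₁, hρ₁'⟩ := Metric.eventually_nhds_iff.1
    (hcont.eventually (Ioo_mem_nhds hXa hXb))
  refine ⟨δ, hδ, r / 2, by positivity, min ρ₁ (δ ⊓ (r / 4)), ?_, hδle.trans (min_le_left _ _),
    fun t ht => hpos t (ht.trans_le hδle), ?_, ?_⟩
  · exact lt_min hρ₁ (lt_min hδ (by positivity))
  · intro t u ht hu hu0 hmemf
    rw [hγ.frontier_eq] at hmemf
    obtain ⟨t', ht'⟩ := hmemf
    refine hu0 (hr' e he0 hpos t t' u (ht.trans_le hδle) ht' ?_)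
    rw [ht', show γ t + u * e - γ t₀ = (γ t - γ t₀) + u * e by ring]
    refine (norm_add_le _ _).trans_lt ?_
    rw [norm_ofReal_mul_unit hnorm]
    have := h₂ (ht.trans_le (min_le_right _ _))
    linarith
  · intro p hp
    have hX : cross p e ∈ Ioo (cross (γ a) e) (cross (γ b) e) :=
      hρ₁' (by rw [dist_eq_norm]; exact hp.trans_le (min_le_left _ _))
    have hab : a ≤ b := by simp only [a, b]; linarith
    obtain ⟨t, ⟨hta, htb⟩, ht⟩ := intermediate_value_Icc hab
      ((continuous_cross e).comp hγ.continuous).continuousOn ⟨hX.1.le, hX.2.le⟩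
    have htδ : |t - t₀| < δ := by
      simp only [a, b] at hta htb
      rw [abs_lt]; constructor <;> linarith
    obtain ⟨u, hu⟩ := exists_eq_mul_of_cross_eq_zero (w := p - γ t) hnorm (by
      simp only [Function.comp_def] at ht
      simp only [cross, Complex.sub_re, Complex.sub_im] at ht ⊢; linarith)
    refine ⟨t, u, htδ, ?_, by rw [← hu]; ring⟩
    rw [← norm_ofReal_mul_unit hnorm, ← hu, show p - γ t = (p - γ t₀) - (γ t - γ t₀) by ring]
    refine (norm_sub_le _ _).trans_lt ?_
    have := h₂ (htδ.trans_le (min_le_right _ _))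
    have := hp.trans_le ((min_le_right _ _).trans (min_le_right _ _))
    linarith

/-- Each side of the curve in a coordinate patch lies in `Ω` as soon as one of its points does. -/
lemma side_subset (hγ : IsSmoothJordanBoundary Ω γ) (hΩ : IsOpen Ω) {t₀ δ h : ℝ} {e : ℂ}
    (hoff : ∀ t u : ℝ, |t - t₀| < δ → |u| < h → u ≠ 0 → γ t + u * e ∉ frontier Ω)
    {J : Set ℝ} (hJ : Convex ℝ J) (hJh : ∀ u ∈ J, |u| < h ∧ u ≠ 0)
    {t₁ u₁ : ℝ} (ht₁ : |t₁ - t₀| < δ) (hu₁ : u₁ ∈ J) (hmem : γ t₁ + u₁ * e ∈ Ω)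
    {t u : ℝ} (ht : |t - t₀| < δ) (hu : u ∈ J) : γ t + u * e ∈ Ω := by
  set F : ℝ × ℝ → ℂ := fun q => γ q.1 + q.2 * e
  have hF : Continuous F := by
    have := hγ.continuous
    fun_prop
  have hball : ∀ {t : ℝ}, t ∈ Metric.ball t₀ δ ↔ |t - t₀| < δ := by
    intro t; rw [Metric.mem_ball, Real.dist_eq]
  have hpre : IsPreconnected (F '' (Metric.ball t₀ δ ×ˢ J)) :=
    ((convex_ball t₀ δ).prod hJ).isPreconnected.image _ hF.continuousOn
  refine subset_of_disjoint_frontier hΩ hpre ?_ ⟨F (t₁, u₁), ⟨_, ⟨hball.2 ht₁, hu₁⟩, rfl⟩, hmem⟩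
    ⟨(t, u), ⟨hball.2 ht, hu⟩, rfl⟩
  rw [disjoint_left]
  rintro _ ⟨⟨t', u'⟩, ⟨ht', hu'⟩, rfl⟩
  exact hoff t' u' (hball.1 ht') (hJh u' hu').1 (hJh u' hu').2

/-- The upper side of a coordinate patch lies in `Ω`. -/
lemma upper_mem (hγ : IsSmoothJordanBoundary Ω γ) (hΩ : IsOpen Ω) {t₀ δ h : ℝ} {e : ℂ}
    (hδ : 0 < δ) (hh : 0 < h) (he : 0 < cross (deriv γ t₀) e)
    (hoff : ∀ t u : ℝ, |t - t₀| < δ → |u| < h → u ≠ 0 → γ t + u * e ∉ frontier Ω)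
    {t u : ℝ} (ht : |t - t₀| < δ) (hu : 0 < u) (huh : u < h) : γ t + u * e ∈ Ω := by
  obtain ⟨s, hs, hs0, hsh⟩ := ((hγ.eventually_mem_of_cross_pos hΩ he).and
    (Ioo_mem_nhdsGT hh)).exists
  exact hγ.side_subset hΩ hoff (convex_Ioo 0 h)
    (fun u hu => ⟨by rw [abs_of_pos hu.1]; exact hu.2, hu.1.ne'⟩)
    (by simpa using hδ) ⟨hs0, hsh⟩ hs ht ⟨hu, huh⟩

lemma lower_mem_of_mem (hγ : IsSmoothJordanBoundary Ω γ) (hΩ : IsOpen Ω) {t₀ δ h : ℝ} {e : ℂ}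
    (hoff : ∀ t u : ℝ, |t - t₀| < δ → |u| < h → u ≠ 0 → γ t + u * e ∉ frontier Ω)
    {t₁ u₁ : ℝ} (ht₁ : |t₁ - t₀| < δ) (hu₁ : u₁ < 0) (hu₁h : -h < u₁)
    (hmem : γ t₁ + u₁ * e ∈ Ω)
    {t u : ℝ} (ht : |t - t₀| < δ) (hu : u < 0) (huh : -h < u) : γ t + u * e ∈ Ω :=
  hγ.side_subset hΩ hoff (convex_Ioo (-h) 0)
    (fun u hu => ⟨by rw [abs_of_neg hu.2]; linarith [hu.1], hu.2.ne⟩) ht₁ ⟨hu₁h, hu₁⟩ hmem ht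
    ⟨huh, hu⟩

lemma mem_interior_closure_of_sides (hγ : IsSmoothJordanBoundary Ω γ) {t₀ δ h ρ : ℝ} {e : ℂ}
    (hρ : 0 < ρ)
    (hup : ∀ t u : ℝ, |t - t₀| < δ → 0 < u → u < h → γ t + u * e ∈ Ω)
    (hlow : ∀ t u : ℝ, |t - t₀| < δ → u < 0 → -h < u → γ t + u * e ∈ Ω)
    (hcov : ∀ p : ℂ, ‖p - γ t₀‖ < ρ →
      ∃ t u : ℝ, |t - t₀| < δ ∧ |u| < h ∧ p = γ t + u * e) :
    γ t₀ ∈ interior (closure Ω) := by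
  rw [mem_interior_iff_mem_nhds]
  refine Filter.mem_of_superset (Metric.ball_mem_nhds _ hρ) fun p hp => ?_
  rw [Metric.mem_ball, dist_eq_norm] at hp
  obtain ⟨t, u, ht, hu, rfl⟩ := hcov p hp
  rw [abs_lt] at hu
  rcases lt_trichotomy u 0 with h0 | rfl | h0
  · exact subset_closure (hlow t u ht h0 hu.1)
  · simpa using hγ.mem_closure t
  · exact subset_closure (hup t u ht h0 hu.2)

/-- `Ω` lies on one side of the curve only. The parameters `t` such that `Ω` is on both sides of the
curve near `γ t` form a clopen set. If it were all of `ℝ`, the closure of `Ω` would be clopen. -/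
lemma notMem_interior_closure (hγ : IsSmoothJordanBoundary Ω γ) (hΩ : IsOpen Ω)
    (hb : Bornology.IsBounded Ω) (t : ℝ) : γ t ∉ interior (closure Ω) := by
  set T : Set ℝ := γ ⁻¹' interior (closure Ω) with hT
  have hTo : IsOpen T := isOpen_interior.preimage hγ.continuous
  have hTc : IsClosed T := by
    refine isClosed_of_closure_subset fun t₀ ht₀ => ?_
    set n := Complex.I * deriv γ t₀ with hn
    have hn0 : 0 < ‖n‖ := by simpa [hn] using hγ.deriv_ne_zero t₀
    set e : ℂ := ((‖n‖⁻¹ : ℝ) : ℂ) * n with hedef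
    have hnorm : ‖e‖ = 1 := by
      rw [hedef, norm_mul, Complex.norm_real, norm_inv, norm_norm, inv_mul_cancel₀ hn0.ne']
    have he : 0 < cross (deriv γ t₀) e := by
      rw [hedef, cross_smul_right, hn, cross_I_mul_self]
      have := norm_pos_iff.2 (hγ.deriv_ne_zero t₀)
      positivity
    obtain ⟨δ, hδ, h, hh, ρ, hρ, -, -, hoff, hcov⟩ := hγ.exists_coordinates hnorm he one_pos
    obtain ⟨t₁, ht₁T, ht₁⟩ := Metric.mem_closure_iff.1 ht₀ δ hδ
    rw [dist_comm, Real.dist_eq] at ht₁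
    have hc : Continuous fun s : ℝ => γ t₁ + s * e := by fun_prop
    have hev : ∀ᶠ s : ℝ in 𝓝 0, γ t₁ + s * e ∈ interior (closure Ω) :=
      (hc.tendsto 0).eventually (isOpen_interior.mem_nhds (by simpa [T] using ht₁T))
    obtain ⟨s, hs, hsh, hs0⟩ := ((hev.filter_mono (nhdsWithin_le_nhds (s := Iio 0))).and
      (Ioo_mem_nhdsLT (by linarith : -h < 0))).exists
    have hsΩ : γ t₁ + s * e ∈ Ω := by
      by_contra hcon
      refine hoff t₁ s ht₁ (by rw [abs_of_neg hs0]; linarith) hs0.ne ?_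
      rw [hΩ.frontier_eq]
      exact ⟨interior_subset hs, hcon⟩
    exact hγ.mem_interior_closure_of_sides hρ
      (fun t u ht hu huh => hγ.upper_mem hΩ hδ hh he hoff ht hu huh)
      (fun t u ht hu huh => hγ.lower_mem_of_mem hΩ hoff ht₁ hs0 hsh hsΩ ht hu huh) hcov
  intro ht
  have hTu : T = univ := IsClopen.eq_univ ⟨hTc, hTo⟩ ⟨t, ht⟩
  have hsub : closure Ω ⊆ interior (closure Ω) := by
    intro p hp
    by_cases hpΩ : p ∈ Ω
    · exact interior_maximal subset_closure hΩ hpΩ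
    · have : p ∈ frontier Ω := by rw [hΩ.frontier_eq]; exact ⟨hp, hpΩ⟩
      rw [hγ.frontier_eq] at this
      obtain ⟨s, rfl⟩ := this
      exact (hTu ▸ mem_univ s : s ∈ T)
  have hopen : IsOpen (closure Ω) := by
    rw [← subset_interior_iff_isOpen]; exact hsub
  have huniv : closure Ω = univ :=
    IsClopen.eq_univ ⟨isClosed_closure, hopen⟩ ⟨γ 0, hγ.mem_closure 0⟩
  have := hb.closure
  rw [huniv] at this
  exact NormedSpace.unbounded_univ ℝ ℂ this

/-- Near a boundary point, in coordinates `γ t + u * e` with `e` pointing to the left of `γ`, the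
domain is given by `u > 0`. -/
lemma exists_chart (hγ : IsSmoothJordanBoundary Ω γ) (hΩ : IsOpen Ω)
    (hb : Bornology.IsBounded Ω) {t₀ : ℝ} {e : ℂ} (hnorm : ‖e‖ = 1)
    (he : 0 < cross (deriv γ t₀) e) {δ₀ : ℝ} (hδ₀ : 0 < δ₀) :
    ∃ δ > 0, ∃ h > 0, ∃ ρ > 0, δ ≤ δ₀ ∧
      (∀ t, |t - t₀| < δ → 0 < cross (deriv γ t) e) ∧
      (∀ t u : ℝ, |t - t₀| < δ → |u| < h → (γ t + u * e ∈ Ω ↔ 0 < u)) ∧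
      (∀ p : ℂ, ‖p - γ t₀‖ < ρ → ∃ t u : ℝ, |t - t₀| < δ ∧ |u| < h ∧ p = γ t + u * e) := by
  obtain ⟨δ, hδ, h, hh, ρ, hρ, hδle, hpos, hoff, hcov⟩ := hγ.exists_coordinates hnorm he hδ₀
  refine ⟨δ, hδ, h, hh, ρ, hρ, hδle, hpos, fun t u ht hu => ?_, hcov⟩
  have hu' := abs_lt.1 hu
  refine ⟨fun hmem => ?_, fun hu0 => hγ.upper_mem hΩ hδ hh he hoff ht hu0 hu'.2⟩
  by_contra hcon
  rcases (not_lt.1 hcon).eq_or_lt with rfl | h0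
  · exact hγ.notMem hΩ t (by simpa using hmem)
  · exact hγ.notMem_interior_closure hΩ hb t₀ (hγ.mem_interior_closure_of_sides hρ
      (fun t u ht hu huh => hγ.upper_mem hΩ hδ hh he hoff ht hu huh)
      (fun t u ht' hu huh => hγ.lower_mem_of_mem hΩ hoff ht h0 hu'.1 hmem ht' hu huh) hcov)

/-- Near a boundary point, moving in the direction `e` does not leave the domain. -/
lemma add_mem (hγ : IsSmoothJordanBoundary Ω γ)
    {t₀ δ h ρ : ℝ} {e : ℂ} (hnorm : ‖e‖ = 1)
    (hpos : ∀ t, |t - t₀| < δ → 0 < cross (deriv γ t) e)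
    (hmem : ∀ t u : ℝ, |t - t₀| < δ → |u| < h → (γ t + u * e ∈ Ω ↔ 0 < u))
    (hcov : ∀ p : ℂ, ‖p - γ t₀‖ < ρ →
      ∃ t u : ℝ, |t - t₀| < δ ∧ |u| < h ∧ p = γ t + u * e)
    {p : ℂ} (hp : ‖p - γ t₀‖ < ρ) (hpΩ : p ∈ Ω) {s : ℝ} (hs : 0 ≤ s)
    (hps : ‖p + s * e - γ t₀‖ < ρ) : p + s * e ∈ Ω := by
  obtain ⟨t, u, ht, hu, rfl⟩ := hcov p hp
  obtain ⟨t', u', ht', hu', heq⟩ := hcov _ hps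
  have hu0 := (hmem t u ht hu).1 hpΩ
  have hcr : cross (γ t) e = cross (γ t') e := by
    have : cross (γ t + u * e + s * e) e = cross (γ t' + u' * e) e := by rw [heq]
    simp [cross] at this ⊢
    linarith
  have htt : t = t' := (hγ.strictMonoOn_cross hpos).injOn
    (by rwa [Metric.mem_ball, Real.dist_eq]) (by rwa [Metric.mem_ball, Real.dist_eq]) hcr
  subst htt
  have he0 : e ≠ 0 := by rintro rfl; simp at hnorm
  have huu : (u : ℂ) + s = u' := by
    apply mul_right_cancel₀ he0; linear_combination heq
  have huu' : u + s = u' := by exact_mod_cast huu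
  rw [heq]
  exact (hmem t u' ht hu').2 (by linarith)

end IsSmoothJordanBoundary

/-! ### The inner parts -/

lemma isOpen_innerPart (hΩ : IsOpen Ω) (ε : ℝ) : IsOpen (innerPart Ω ε) :=
  hΩ.inter (isOpen_lt continuous_const (Metric.continuous_infDist_pt _))

lemma innerPart_subset (ε : ℝ) : innerPart Ω ε ⊆ Ω := fun _ h => h.1

lemma closure_innerPart_subset (hΩ : IsOpen Ω) {ε : ℝ} (hε : 0 < ε) :
    closure (innerPart Ω ε) ⊆ Ω := by
  intro p hp
  have h1 : p ∈ closure Ω := closure_mono (innerPart_subset ε) hp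
  have h2 : ε ≤ Metric.infDist p (frontier Ω) := by
    have : closure (innerPart Ω ε) ⊆ {p | ε ≤ Metric.infDist p (frontier Ω)} :=
      closure_minimal (fun q hq => hq.2.le)
        (isClosed_le continuous_const (Metric.continuous_infDist_pt _))
    exact this hp
  by_contra hcon
  have h3 : p ∈ frontier Ω := by rw [hΩ.frontier_eq]; exact ⟨h1, hcon⟩
  rw [Metric.infDist_zero_of_mem h3] at h2
  linarith

lemma isCompact_closure_innerPart (hb : Bornology.IsBounded Ω) (ε : ℝ) :
    IsCompact (closure (innerPart Ω ε)) :=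
  (hb.subset (innerPart_subset ε)).isCompact_closure

lemma eventually_subset_innerPart (hΩ : IsOpen Ω) (hne : (frontier Ω).Nonempty) {K : Set ℂ}
    (hK : IsCompact K) (hKΩ : K ⊆ Ω) : ∀ᶠ ε : ℝ in 𝓝[>] 0, K ⊆ innerPart Ω ε := by
  have hd : Disjoint K (frontier Ω) :=
    disjoint_left.2 fun p hp hf => by rw [hΩ.frontier_eq] at hf; exact hf.2 (hKΩ hp)
  obtain ⟨r, hr, h⟩ := Metric.exists_pos_forall_lt_edist hK isClosed_frontier hd
  filter_upwards [Ioo_mem_nhdsGT (show (0 : ℝ) < r from hr)] with ε hε p hp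
  refine ⟨hKΩ hp, ?_⟩
  obtain ⟨c, hc, hc'⟩ := isClosed_frontier.exists_infDist_eq_dist hne p
  rw [hc']
  have := h p hp c hc
  rw [edist_nndist, ENNReal.coe_lt_coe] at this
  exact hε.2.trans (by exact_mod_cast this)

lemma eventually_mem_innerPart (hΩ : IsOpen Ω) (hne : (frontier Ω).Nonempty) {p : ℂ}
    (hp : p ∈ Ω) : ∀ᶠ ε : ℝ in 𝓝[>] 0, p ∈ innerPart Ω ε := by
  simpa using eventually_subset_innerPart hΩ hne (isCompact_singleton (x := p)) (by simpa using hp)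

/-- If moving in the direction `e` near `c₀` does not leave `Ω`, neither does it leave the inner
part: translate a nearest boundary point back along `e`. -/
lemma add_mem_innerPart (hΩ : IsOpen Ω) (hne : (frontier Ω).Nonempty) {c₀ e : ℂ} {ρ ε : ℝ}
    (hε : ε < ρ / 2)
    (hM : ∀ p : ℂ, ‖p - c₀‖ < ρ → p ∈ Ω → ∀ s : ℝ, 0 ≤ s → ‖p + s * e - c₀‖ < ρ → p + s * e ∈ Ω)
    {p : ℂ} (hp : ‖p - c₀‖ < ρ / 2) (hpΩ : p ∈ innerPart Ω ε) {s : ℝ} (hs : 0 ≤ s)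
    (hps : ‖p + s * e - c₀‖ < ρ / 2) : p + s * e ∈ innerPart Ω ε := by
  have hρ : 0 < ρ / 2 := (norm_nonneg _).trans_lt hp
  refine ⟨hM p (by linarith) hpΩ.1 s hs (by linarith), ?_⟩
  by_contra hcon
  obtain ⟨c, hc, hc'⟩ := isClosed_frontier.exists_infDist_eq_dist hne (p + s * e)
  rw [not_lt, hc'] at hcon
  have hqd : dist (c - s * e) p ≤ ε := by
    rw [dist_comm, dist_eq_norm] at hcon
    rw [dist_eq_norm]
    rwa [show c - s * e - p = c - (p + s * e) by ring]
  have hq : c - s * e ∈ Ω := by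
    refine subset_of_disjoint_frontier hΩ (convex_closedBall p ε).isPreconnected ?_
      ⟨p, Metric.mem_closedBall_self (dist_nonneg.trans hqd), hpΩ.1⟩ hqd
    rw [disjoint_left]
    intro w hw hwf
    have h1 := Metric.infDist_le_dist_of_mem (x := p) hwf
    have h2 := hpΩ.2
    rw [Metric.mem_closedBall, dist_comm] at hw
    linarith
  have hcΩ : c ∈ Ω := by
    have := hM (c - s * e) ?_ hq s hs ?_
    · simpa using this
    · rw [dist_eq_norm] at hqd
      have := norm_add_le (c - s * e - p) (p - c₀)
      rw [sub_add_sub_cancel] at this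
      linarith
    · rw [dist_comm, dist_eq_norm] at hcon
      have := norm_add_le (c - (p + s * e)) (p + s * e - c₀)
      rw [sub_add_sub_cancel] at this
      rw [sub_add_cancel]
      linarith
  rw [hΩ.frontier_eq] at hc
  exact hc.2 hcΩ

/-! ### Integration along parallel lines -/

lemma cross_mul_sub_I {e : ℂ} (he : ‖e‖ = 1) (s x : ℝ) :
    cross (e * (s - Complex.I * x)) e = x := by
  have h1 : e.re * e.re + e.im * e.im = 1 := by
    rw [← Complex.normSq_apply, Complex.normSq_eq_norm_sq, he]; norm_num
  simp [cross]; linear_combination x * h1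

/-- Orthonormal coordinates whose second axis points in the direction `e`. -/
lemma exists_measurePreserving {e : ℂ} (he : ‖e‖ = 1) :
    ∃ T : ℝ × ℝ ≃ᵐ ℂ, MeasurePreserving T volume volume ∧
      ∀ x s : ℝ, T (x, s) = e * (s - Complex.I * x) := by
  set a : Circle := ⟨-Complex.I * e, by simp [Submonoid.unitSphere, he]⟩
  refine ⟨Complex.measurableEquivRealProd.symm.trans (rotation a).toMeasurableEquiv, ?_, ?_⟩
  · exact (rotation a).measurePreserving.comp Complex.volume_preserving_equiv_real_prod.symm
  · intro x s
    have h : rotation a (⟨x, s⟩ : ℂ) = -Complex.I * e * ⟨x, s⟩ := rotation_apply _ _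
    rw [Complex.mk_eq_add_mul_I] at h
    refine (show _ = rotation a (⟨x, s⟩ : ℂ) from rfl).trans ?_
    rw [Complex.mk_eq_add_mul_I, h]
    linear_combination -e * s * Complex.I_sq

lemma ae_integrable_lines {E : Type*} [NormedAddCommGroup E] {F : ℂ → E} {e : ℂ} (he : ‖e‖ = 1) (hF : Integrable F) :
    ∀ᵐ x : ℝ, Integrable fun s : ℝ => F (e * (s - Complex.I * x)) := by
  obtain ⟨T, hT, hT'⟩ := exists_measurePreserving he
  have : Integrable (F ∘ T) (volume.prod volume) :=
    (hT.integrable_comp_emb T.measurableEmbedding).2 hF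
  simpa only [Function.comp_apply, hT'] using this.prod_right_ae

section Fubini
variable {E : Type*} [NormedAddCommGroup E] [NormedSpace ℝ E] {F : ℂ → E} {e : ℂ}

lemma integral_eq_integral_lines (he : ‖e‖ = 1) (hF : Integrable F) :
    ∫ p, F p = ∫ x : ℝ, ∫ s : ℝ, F (e * (s - Complex.I * x)) := by
  obtain ⟨T, hT, hT'⟩ := exists_measurePreserving he
  rw [← hT.integral_comp T.measurableEmbedding,
    show (volume : Measure (ℝ × ℝ)) = volume.prod volume from rfl, integral_prod]
  · simp only [hT']
  · exact (hT.integrable_comp_emb T.measurableEmbedding).2 hF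

lemma integrable_integral_lines (he : ‖e‖ = 1) (hF : Integrable F) :
    Integrable fun x : ℝ => ∫ s : ℝ, F (e * (s - Complex.I * x)) := by
  obtain ⟨T, hT, hT'⟩ := exists_measurePreserving he
  have : Integrable (F ∘ T) (volume.prod volume) :=
    (hT.integrable_comp_emb T.measurableEmbedding).2 hF
  simpa only [Function.comp_apply, hT'] using this.integral_prod_left

lemma integral_line_eq (he : ‖e‖ = 1) (p : ℂ) :
    ∫ s : ℝ, F (e * (s - Complex.I * cross p e)) = ∫ u : ℝ, F (p + u * e) := by
  obtain ⟨u₀, hu₀⟩ := exists_eq_mul_of_cross_eq_zero (w := p - e * (0 - Complex.I * cross p e)) he (by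
    have := cross_mul_sub_I he 0 (cross p e)
    simp only [cross, Complex.sub_re, Complex.sub_im] at this ⊢
    simp only [Complex.ofReal_zero] at this
    linarith)
  rw [← integral_add_right_eq_self _ u₀]
  congr 1; ext u; congr 1
  push_cast
  linear_combination -hu₀

end Fubini

/-- One-dimensional fundamental theorem of calculus along a ray which enters the inner part once and
then leaves the support of `g`: the integral is minus the value of `g` at the point of entry. -/
lemma integral_slice (hΩ : IsOpen Ω) {g : ℂ → ℂ} (hg : ContDiffOn ℝ 1 g Ω) {c₀ c e : ℂ}
    (he : ‖e‖ = 1) {r R ε : ℝ} (hrR : r < R) (hε : 0 < ε)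
    (hsupp : ∀ p, r < ‖p - c₀‖ → g p = 0)
    (hup : ∀ u v : ℝ, u ≤ v → ‖c + u * e - c₀‖ < R → ‖c + v * e - c₀‖ < R →
      c + u * e ∈ innerPart Ω ε → c + v * e ∈ innerPart Ω ε)
    (hpos : ∀ u : ℝ, ‖c + u * e - c₀‖ < R → c + u * e ∈ innerPart Ω ε → 0 ≤ u) :
    ((∀ u : ℝ, ‖c + u * e - c₀‖ < R → c + u * e ∉ innerPart Ω ε) ∧
      ∫ u : ℝ, (innerPart Ω ε).indicator (fun p => fderiv ℝ g p e) (c + u * e) = 0) ∨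
    ∃ m : ℝ, 0 ≤ m ∧ c + m * e ∈ Ω ∧
      (∀ u : ℝ, ‖c + u * e - c₀‖ < R → c + u * e ∈ innerPart Ω ε → m ≤ u) ∧
      ∫ u : ℝ, (innerPart Ω ε).indicator (fun p => fderiv ℝ g p e) (c + u * e) =
        -g (c + m * e) := by
  have hline : Continuous fun u : ℝ => c + u * e := by fun_prop
  have hfd0 : ∀ p, r < ‖p - c₀‖ → fderiv ℝ g p = 0 := fun p hp => by
    have : g =ᶠ[𝓝 p] fun _ => 0 := by
      have : ∀ᶠ q in 𝓝 p, r < ‖q - c₀‖ :=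
        (isOpen_lt continuous_const (by fun_prop : Continuous fun q => ‖q - c₀‖)).mem_nhds hp
      exact this.mono hsupp
    rw [this.fderiv_eq]; simp
  set A : Set ℝ := {u | ‖c + u * e - c₀‖ < R}
  set S : Set ℝ := {u | u ∈ A ∧ c + u * e ∈ innerPart Ω ε}
  have hAo : IsOpen A := isOpen_lt (by fun_prop) continuous_const
  have hAconv : A.OrdConnected := by
    have : A = (fun u : ℝ => c + u * e) ⁻¹' Metric.ball c₀ R := by
      ext u; simp [A, dist_eq_norm]
    rw [this]
    have h2 : (fun u : ℝ => c + u * e) = AffineMap.lineMap (k := ℝ) c (c + e) := by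
      ext u; simp [AffineMap.lineMap_apply, add_comm]
    rw [h2]
    exact ((convex_ball c₀ R).affine_preimage _).ordConnected
  by_cases hS : S.Nonempty
  swap
  · left
    have hS' : ∀ u : ℝ, u ∈ A → c + u * e ∉ innerPart Ω ε := fun u hu hu' => hS ⟨u, hu, hu'⟩
    refine ⟨hS', ?_⟩
    rw [← integral_zero ℝ ℂ]
    congr 1; ext u
    by_cases hu : u ∈ A
    · rw [indicator_of_notMem (hS' u hu)]
    · have : r < ‖c + u * e - c₀‖ := hrR.trans_le (not_lt.1 hu)
      by_cases hu' : c + u * e ∈ innerPart Ω ε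
      · rw [indicator_of_mem hu', hfd0 _ this]; simp
      · rw [indicator_of_notMem hu']
  right
  have hbdd : BddBelow S := ⟨0, fun u hu => hpos u hu.1 hu.2⟩
  set m := sInf S
  obtain ⟨u₁, hu₁⟩ := hS
  -- a parameter beyond the support of `g`
  obtain ⟨b, hbA, hub, hb⟩ : ∃ b ∈ A, u₁ < b ∧ ∀ u : ℝ, ‖c + u * e - c₀‖ ≤ r → u < b := by
    set B : Set ℝ := {u | ‖c + u * e - c₀‖ ≤ r} ∪ {u₁}
    have hBA : B ⊆ A := by
      rintro u (hu | rfl)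
      · exact lt_of_le_of_lt hu hrR
      · exact hu₁.1
    have hBb : Bornology.IsBounded {u : ℝ | ‖c + u * e - c₀‖ ≤ r} := by
      refine (Metric.isBounded_iff_subset_closedBall 0).2 ⟨r + ‖c - c₀‖, fun u hu => ?_⟩
      rw [mem_closedBall_zero_iff, Real.norm_eq_abs, ← norm_ofReal_mul_unit he,
        show (u : ℂ) * e = (c + u * e - c₀) - (c - c₀) by ring]
      exact (norm_sub_le _ _).trans (add_le_add_left hu _)
    have hBc : IsCompact B :=
      (Metric.isCompact_of_isClosed_isBounded (isClosed_le (by fun_prop) continuous_const)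
        hBb).union isCompact_singleton
    have hmax := hBc.sSup_mem ⟨u₁, by simp [B]⟩
    obtain ⟨b, hb, hb'⟩ := Filter.nonempty_of_mem (inter_mem (nhdsWithin_le_nhds
      (hAo.mem_nhds (hBA hmax))) (self_mem_nhdsWithin (a := sSup B) (s := Ioi (sSup B))))
    exact ⟨b, hb, (le_csSup hBc.bddAbove (by simp [B])).trans_lt hb',
      fun u hu => (le_csSup hBc.bddAbove (by left; exact hu)).trans_lt hb'⟩
  have hmb : m ≤ b := (csInf_le hbdd hu₁).trans hub.le
  have hIoc : ∀ u ∈ Ioc m b, u ∈ S := fun u hu => by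
    obtain ⟨u₀, hu₀, hlt⟩ := exists_lt_of_csInf_lt ⟨u₁, hu₁⟩ hu.1
    have huA : u ∈ A := hAconv.out hu₀.1 hbA ⟨hlt.le, hu.2⟩
    exact ⟨huA, hup u₀ u hlt.le hu₀.1 huA hu₀.2⟩
  have hmcl : c + m * e ∈ closure (innerPart Ω ε) := by
    have h1 : m ∈ closure S := csInf_mem_closure ⟨u₁, hu₁⟩ hbdd
    exact map_mem_closure (f := fun u : ℝ => c + u * e) hline h1 fun u hu => hu.2
  have hIcc : ∀ u ∈ Icc m b, c + u * e ∈ Ω := fun u hu => by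
    rcases hu.1.eq_or_lt with rfl | h
    · exact closure_innerPart_subset hΩ hε hmcl
    · exact (hIoc u ⟨h, hu.2⟩).2.1
  refine ⟨m, le_csInf ⟨u₁, hu₁⟩ fun u hu => hpos u hu.1 hu.2, hIcc m ⟨le_rfl, hmb⟩,
    fun u hu hu' => csInf_le hbdd ⟨hu, hu'⟩, ?_⟩
  have hae : (fun u : ℝ => (innerPart Ω ε).indicator (fun p => fderiv ℝ g p e) (c + u * e)) =ᵐ[volume]
      (Ioc m b).indicator fun u : ℝ => fderiv ℝ g (c + u * e) e := by
    have : ∀ᵐ u : ℝ, u ≠ m := by simp [ae_iff]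
    filter_upwards [this] with u hum
    by_cases hu : u ∈ Ioc m b
    · rw [indicator_of_mem hu, indicator_of_mem (hIoc u hu).2]
    rw [indicator_of_notMem hu]
    by_cases hu' : c + u * e ∈ innerPart Ω ε
    swap
    · rw [indicator_of_notMem hu']
    rw [indicator_of_mem hu']
    by_cases hur : r < ‖c + u * e - c₀‖
    · rw [hfd0 _ hur]; simp
    · exfalso
      have h1 := hb u (not_lt.1 hur)
      have h2 : m ≤ u := csInf_le hbdd ⟨(not_lt.1 hur).trans_lt hrR, hu'⟩
      exact hu ⟨lt_of_le_of_ne h2 (Ne.symm hum), h1.le⟩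
  rw [integral_congr_ae hae, integral_indicator measurableSet_Ioc,
    ← intervalIntegral.integral_of_le hmb]
  have hderiv : ∀ u ∈ uIcc m b,
      HasDerivAt (fun u : ℝ => g (c + u * e)) (fderiv ℝ g (c + u * e) e) u := fun u hu => by
    rw [uIcc_of_le hmb] at hu
    have h1 : HasFDerivAt g (fderiv ℝ g (c + u * e)) (c + u * e) :=
      ((hg.differentiableOn (by norm_num)).differentiableAt
        (hΩ.mem_nhds (hIcc u hu))).hasFDerivAt
    have h2 : HasDerivAt (fun u : ℝ => c + u * e) e u := by
      simpa using ((Complex.ofRealCLM.hasDerivAt (x := u)).mul_const e).const_add c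
    exact h1.comp_hasDerivAt u h2
  have hcont : ContinuousOn (fun u : ℝ => fderiv ℝ g (c + u * e) e) (uIcc m b) := by
    rw [uIcc_of_le hmb]
    have h1 : ContinuousOn (fderiv ℝ g) Ω := hg.continuousOn_fderiv_of_isOpen hΩ (by norm_num)
    exact (h1.comp hline.continuousOn hIcc).clm_apply continuousOn_const
  rw [intervalIntegral.integral_eq_sub_of_hasDerivAt hderiv hcont.intervalIntegrable]
  have : g (c + b * e) = 0 := by
    apply hsupp
    by_contra hcon
    exact lt_irrefl _ (hb b (not_lt.1 hcon))
  rw [this, zero_sub]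

/-! ### The divergence theorem near a boundary point -/

/-- Data for the divergence theorem near `γ t₀` in the direction `e`: a parameter interval of radius
`δ` about `t₀`, a large ball of radius `R` in which `Ω` is the side `u > 0` of the curve, and a small
ball of radius `r` that the lines `γ t + ℝ e` with `|t - t₀| < δ` cover. -/
lemma IsSmoothJordanBoundary.exists_window (hγ : IsSmoothJordanBoundary Ω γ) (hΩ : IsOpen Ω)
    (hb : Bornology.IsBounded Ω) {t₀ : ℝ} {e : ℂ} (he : ‖e‖ = 1)
    (hcr : 0 < cross (deriv γ t₀) e) :
    ∃ δ > 0, ∃ R > 0, ∃ r > 0, δ < 1 / 2 ∧ r < R ∧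
      (∀ t, |t - t₀| < δ → 0 < cross (deriv γ t) e) ∧
      (∀ t, |t - t₀| < δ → ‖γ t - γ t₀‖ < R) ∧
      (∀ t u : ℝ, |t - t₀| < δ → ‖γ t + u * e - γ t₀‖ < R → (γ t + u * e ∈ Ω ↔ 0 < u)) ∧
      (∀ ε < R, ∀ c : ℂ, ∀ u v : ℝ, u ≤ v → ‖c + u * e - γ t₀‖ < R → ‖c + v * e - γ t₀‖ < R →
        c + u * e ∈ innerPart Ω ε → c + v * e ∈ innerPart Ω ε) ∧
      (∀ p : ℂ, ‖p - γ t₀‖ ≤ r → ∃ t, |t - t₀| < δ ∧ cross (γ t) e = cross p e) ∧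
      (∀ t, ‖γ t - γ t₀‖ ≤ r → ∃ n : ℤ, |t - t₀ - n| < δ) := by
  obtain ⟨δ₁, hδ₁, h₁, hh₁, ρ₁, hρ₁, -, hpos₁, hmem₁, hcov₁⟩ :=
    hγ.exists_chart hΩ hb he hcr one_pos
  obtain ⟨δ', hδ', hδ''⟩ := Metric.continuousAt_iff.1 (hγ.continuous.continuousAt (x := t₀))
    (ρ₁ / 2) (by positivity)
  simp only [dist_eq_norm] at hδ''
  obtain ⟨δ, hδ, h₂, hh₂, ρ₂, hρ₂, hδle, hpos₂, -, hcov₂⟩ :=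
    hγ.exists_chart hΩ hb he hcr (lt_min (lt_min hδ' hδ₁) (by norm_num : (0 : ℝ) < 1 / 4))
  have hδle' : δ ≤ δ' := hδle.trans ((min_le_left _ _).trans (min_le_left _ _))
  have hδle₁ : δ ≤ δ₁ := hδle.trans ((min_le_left _ _).trans (min_le_right _ _))
  have hδle₄ : δ ≤ 1 / 4 := hδle.trans (min_le_right _ _)
  obtain ⟨ρ₃, hρ₃, hpar⟩ := hγ.exists_param_near t₀ hδ
  have hne : (frontier Ω).Nonempty := ⟨_, hγ.mem_frontier 0⟩
  have he0 : e ≠ 0 := by rintro rfl; simp at he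
  set r := min (ρ₁ / 2) (min ρ₂ ρ₃) / 2
  have hr0 : 0 < min (ρ₁ / 2) (min ρ₂ ρ₃) := by positivity
  have hr : 0 < r := half_pos hr0
  have hr' : r < min (ρ₁ / 2) (min ρ₂ ρ₃) := half_lt_self hr0
  refine ⟨δ, hδ, ρ₁ / 2, by positivity, r, hr, by linarith, hr'.trans_le (min_le_left _ _), hpos₂,
    fun t ht => hδ'' (ht.trans_le hδle'), ?_, ?_, ?_, ?_⟩
  · intro t u ht hu
    obtain ⟨t', u', ht', hu', heq⟩ := hcov₁ (γ t + u * e) (by linarith)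
    have hcr' : cross (γ t) e = cross (γ t') e := by
      have : cross (γ t + u * e) e = cross (γ t' + u' * e) e := by rw [heq]
      simp [cross] at this ⊢
      linarith
    have htt : t = t' := (hγ.strictMonoOn_cross hpos₁).injOn
      (by rw [Metric.mem_ball, Real.dist_eq]; linarith)
      (by rwa [Metric.mem_ball, Real.dist_eq]) hcr'
    subst htt
    have huu : (u : ℂ) = u' := mul_right_cancel₀ he0 (add_left_cancel heq)
    have huu' : u = u' := by exact_mod_cast huu
    subst huu'
    exact hmem₁ t u ht' hu'
  · intro ε hε c u v huv hu hv hmem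
    have h3 : c + v * e = c + u * e + ((v - u : ℝ) : ℂ) * e := by push_cast; ring
    rw [h3] at hv ⊢
    exact add_mem_innerPart hΩ hne hε
      (fun p hp hpΩ s hs hps => hγ.add_mem he hpos₁ hmem₁ hcov₁ hp hpΩ hs hps)
      hu hmem (sub_nonneg.2 huv) hv
  · intro p hp
    obtain ⟨t, u, ht, -, rfl⟩ := hcov₂ p (hp.trans_lt (hr'.trans_le
      ((min_le_right _ _).trans (min_le_left _ _))))
    exact ⟨t, ht, by simp [cross]; ring⟩
  · intro t ht
    exact hpar t (ht.trans_lt (hr'.trans_le ((min_le_right _ _).trans (min_le_right _ _))))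

lemma integrableOn_innerPart (hΩ : IsOpen Ω) (hb : Bornology.IsBounded Ω) {ε : ℝ} (hε : 0 < ε)
    {E : Type*} [NormedAddCommGroup E] {F : ℂ → E} (hF : ContinuousOn F Ω) :
    IntegrableOn F (innerPart Ω ε) :=
  ((hF.mono (closure_innerPart_subset hΩ hε)).integrableOn_compact
    (isCompact_closure_innerPart hb ε)).mono_set subset_closure

lemma continuousOn_fderiv_apply (hΩ : IsOpen Ω) {g : ℂ → ℂ} (hg : ContDiffOn ℝ 1 g Ω) (v : ℂ) :
    ContinuousOn (fun p => fderiv ℝ g p v) Ω :=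
  (hg.continuousOn_fderiv_of_isOpen hΩ (by norm_num)).clm_apply continuousOn_const

/-- The divergence theorem for the vector field `g v`: the integrals of the directional derivative
`∂_v g` over the inner parts of `Ω` converge to the flux of `g v` through `γ`. -/
def HasFlux (Ω : Set ℂ) (γ : ℝ → ℂ) (v : ℂ) (g : ℂ → ℂ) : Prop :=
  Tendsto (fun ε : ℝ => ∫ p in innerPart Ω ε, fderiv ℝ g p v) (𝓝[>] 0)
    (𝓝 (-∫ t in (0 : ℝ)..1, (cross (deriv γ t) v : ℂ) * g (γ t)))

/-- The integral along the line through `γ t` converges to minus the boundary value at `γ t`. -/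
lemma tendsto_integral_slice (hΩ : IsOpen Ω) (hne : (frontier Ω).Nonempty) {g : ℂ → ℂ}
    (hg : ContDiffOn ℝ 1 g Ω) (hgc : ContinuousOn g (closure Ω)) {c₀ c e : ℂ}
    (hc : c ∈ closure Ω) (he : ‖e‖ = 1) {r R : ℝ} (hrR : r < R)
    (hsupp : ∀ p, r < ‖p - c₀‖ → g p = 0) (hcR : ‖c - c₀‖ < R)
    (hup : ∀ ε < R, ∀ u v : ℝ, u ≤ v → ‖c + u * e - c₀‖ < R → ‖c + v * e - c₀‖ < R →
      c + u * e ∈ innerPart Ω ε → c + v * e ∈ innerPart Ω ε)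
    (hside : ∀ u : ℝ, ‖c + u * e - c₀‖ < R → (c + u * e ∈ Ω ↔ 0 < u)) :
    Tendsto (fun ε : ℝ =>
      ∫ u : ℝ, (innerPart Ω ε).indicator (fun p => fderiv ℝ g p e) (c + u * e))
      (𝓝[>] 0) (𝓝 (-g c)) := by
  have hline : Continuous fun u : ℝ => c + u * e := by fun_prop
  have hR : 0 < R := (norm_nonneg _).trans_lt hcR
  rw [Metric.tendsto_nhds]
  intro κ hκ
  -- for small `u ≥ 0` the value at `c + u * e` is close to the value at `c`
  have h1 : Tendsto (fun u : ℝ => c + u * e) (𝓝 0) (𝓝 c) := by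
    simpa using hline.tendsto 0
  have h2 : ∀ᶠ u : ℝ in 𝓝 0, c + u * e ∈ closure Ω → dist (g (c + u * e)) (g c) < κ :=
    h1.eventually (eventually_nhdsWithin_iff.1 ((hgc c hc).eventually (Metric.ball_mem_nhds _ hκ)))
  have h3 : ∀ᶠ u : ℝ in 𝓝 0, ‖c + u * e - c₀‖ < R := by
    have : Continuous fun u : ℝ => ‖c + u * e - c₀‖ := by fun_prop
    exact (this.tendsto 0).eventually (gt_mem_nhds (by simpa using hcR))
  obtain ⟨η, hη, hη'⟩ := Metric.eventually_nhds_iff.1 (h2.and h3)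
  have hη2 := hη' (y := η / 2) (by rw [Real.dist_eq]; rw [abs_lt]; constructor <;> linarith)
  have hmem : c + (η / 2 : ℝ) * e ∈ Ω := (hside _ hη2.2).2 (by positivity)
  filter_upwards [eventually_mem_innerPart hΩ hne hmem, Ioo_mem_nhdsGT hR] with ε hε hεR
  rcases integral_slice hΩ hg he hrR hεR.1 hsupp (hup ε hεR.2)
    (fun u hu hu' => ((hside u hu).1 hu'.1).le) with ⟨hno, -⟩ | ⟨m, hm0, hmΩ, hmle, hint⟩
  · exact absurd hε (hno _ hη2.2)
  · rw [hint, dist_neg_neg]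
    have hmη := hmle _ hη2.2 hε
    exact (hη' (by rw [Real.dist_eq, abs_lt]; constructor <;> linarith)).1 (subset_closure hmΩ)

/-- The divergence theorem for functions supported near a boundary point, in a transversal
direction. -/
lemma exists_hasFlux_of_unit (hΩ : IsOpen Ω) (hb : Bornology.IsBounded Ω)
    (hγ : IsSmoothJordanBoundary Ω γ) {t₀ : ℝ} {e : ℂ} (he : ‖e‖ = 1)
    (hcr : 0 < cross (deriv γ t₀) e) :
    ∃ r > 0, ∀ g : ℂ → ℂ, ContDiffOn ℝ 1 g Ω → ContinuousOn g (closure Ω) →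
      (∀ p, r < ‖p - γ t₀‖ → g p = 0) → HasFlux Ω γ e g := by
  obtain ⟨δ, hδ, R, hR, r, hr, hδ2, hrR, hpos, hγR, hside, hup, hcov, hpar⟩ :=
    hγ.exists_window hΩ hb he hcr
  refine ⟨r, hr, fun g hg hgc hsupp => ?_⟩
  have hne : (frontier Ω).Nonempty := ⟨_, hγ.mem_frontier 0⟩
  obtain ⟨M, hM⟩ := hb.isCompact_closure.exists_bound_of_continuousOn hgc
  have hM0 : 0 ≤ M := (norm_nonneg _).trans (hM _ (hγ.mem_closure 0))
  have hball : ∀ {t : ℝ}, t ∈ Metric.ball t₀ δ ↔ |t - t₀| < δ := by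
    intro t; rw [Metric.mem_ball, Real.dist_eq]
  set I : Set ℝ := Metric.ball t₀ δ
  set X : ℝ → ℝ := fun t => cross (γ t) e
  set X' : ℝ → ℝ := fun t => cross (deriv γ t) e
  have hX'c : Continuous X' := (continuous_cross e).comp hγ.continuous_deriv
  set F : ℝ → ℂ → ℂ := fun ε => (innerPart Ω ε).indicator fun p => fderiv ℝ g p e
  set J : ℝ → ℝ → ℂ := fun ε x => ∫ s : ℝ, F ε (e * (s - Complex.I * x))
  have hF0 : ∀ ε p, r < ‖p - γ t₀‖ → F ε p = 0 := fun ε p hp => by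
    have h0 : g =ᶠ[𝓝 p] fun _ => 0 := by
      have : ∀ᶠ q in 𝓝 p, r < ‖q - γ t₀‖ :=
        (isOpen_lt continuous_const (by fun_prop : Continuous fun q => ‖q - γ t₀‖)).mem_nhds hp
      exact this.mono hsupp
    simp only [F]
    by_cases hp' : p ∈ innerPart Ω ε
    · rw [indicator_of_mem hp', h0.fderiv_eq]; simp
    · rw [indicator_of_notMem hp']
  have hFi : ∀ ε, 0 < ε → Integrable (F ε) := fun ε hε =>
    (integrable_indicator_iff (isOpen_innerPart hΩ ε).measurableSet).2
      (integrableOn_innerPart hΩ hb hε (continuousOn_fderiv_apply hΩ hg e))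
  have hJ0 : ∀ ε x, x ∉ X '' I → J ε x = 0 := fun ε x hx => by
    simp only [J]
    rw [← integral_zero ℝ ℂ]
    congr 1; ext s
    apply hF0
    by_contra hcon
    obtain ⟨t, ht, ht'⟩ := hcov _ (not_lt.1 hcon)
    rw [cross_mul_sub_I he] at ht'
    exact hx ⟨t, hball.2 ht, ht'⟩
  have hXd : ∀ t ∈ I, HasDerivWithinAt X (X' t) I t :=
    fun t _ => (hγ.hasDerivAt_cross e t).hasDerivWithinAt
  have hXi : InjOn X I := (hγ.strictMonoOn_cross hpos).injOn
  have hJslice : ∀ ε t, J ε (X t) = ∫ u : ℝ, F ε (γ t + u * e) := fun ε t =>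
    integral_line_eq he (γ t)
  have hIm : MeasurableSet I := measurableSet_ball
  have hmain : ∀ ε, 0 < ε → ∫ p in innerPart Ω ε, fderiv ℝ g p e =
      ∫ t in I, |X' t| • J ε (X t) := fun ε hε => by
    rw [← integral_image_eq_integral_abs_deriv_smul hIm hXd hXi,
      setIntegral_eq_integral_of_forall_compl_eq_zero (hJ0 ε),
      ← integral_eq_integral_lines he (hFi ε hε),
      integral_indicator (isOpen_innerPart hΩ ε).measurableSet]
  have hmeas : ∀ ε, 0 < ε → AEStronglyMeasurable (fun t => |X' t| • J ε (X t))
      (volume.restrict I) := fun ε hε =>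
    ((integrableOn_image_iff_integrableOn_abs_deriv_smul hIm hXd hXi _).1
      (integrable_integral_lines he (hFi ε hε)).integrableOn).aestronglyMeasurable
  have hlim : Tendsto (fun ε : ℝ => ∫ t in I, |X' t| • J ε (X t)) (𝓝[>] 0)
      (𝓝 (∫ t in I, |X' t| • (-g (γ t)))) := by
    refine tendsto_integral_filter_of_dominated_convergence (fun t => |X' t| * M) ?_ ?_ ?_ ?_
    · filter_upwards [self_mem_nhdsWithin] with ε hε using hmeas ε hε
    · filter_upwards [Ioo_mem_nhdsGT hR] with ε hε
      filter_upwards [ae_restrict_mem hIm] with t ht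
      rw [norm_smul, Real.norm_eq_abs, abs_abs, hJslice]
      refine mul_le_mul_of_nonneg_left ?_ (abs_nonneg _)
      rcases integral_slice (c := γ t) hΩ hg he hrR hε.1 hsupp (hup ε hε.2 (γ t))
        (fun u hu hu' => ((hside t u (hball.1 ht) hu).1 hu'.1).le) with
        ⟨-, h0⟩ | ⟨m, -, hmΩ, -, hint⟩
      · rw [h0, norm_zero]; exact hM0
      · rw [hint, norm_neg]; exact hM _ (subset_closure hmΩ)
    · exact ((hX'c.abs.mul continuous_const).integrableOn_Icc (a := t₀ - δ) (b := t₀ + δ)).mono_set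
        (by rw [← Real.closedBall_eq_Icc]; exact Metric.ball_subset_closedBall)
    · filter_upwards [ae_restrict_mem hIm] with t ht
      refine Tendsto.const_smul ?_ _
      simp only [hJslice]
      exact tendsto_integral_slice hΩ hne hg hgc (hγ.mem_closure t) he hrR hsupp
        (hγR t (hball.1 ht)) (fun ε hε => hup ε hε (γ t)) (fun u hu => hside t u (hball.1 ht) hu)
  have hval : ∫ t in I, |X' t| • (-g (γ t)) =
      -∫ t in (0 : ℝ)..1, (cross (deriv γ t) e : ℂ) * g (γ t) := by
    have hper : Function.Periodic (fun t => (cross (deriv γ t) e : ℂ) * g (γ t)) 1 := by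
      intro t
      have hd : deriv γ (t + 1) = deriv γ t := by
        rw [← deriv_comp_add_const]
        congr 1; ext s; exact hγ.periodic s
      simp only [hd, hγ.periodic t]
    have h1 := hper.intervalIntegral_add_eq 0 (t₀ - 1 / 2)
    rw [zero_add] at h1
    rw [h1, intervalIntegral.integral_of_le (by linarith),
      setIntegral_congr_fun hIm (g := fun t => -((cross (deriv γ t) e : ℂ) * g (γ t))),
      integral_neg]
    · congr 1
      refine (setIntegral_eq_of_subset_of_forall_sdiff_eq_zero measurableSet_Ioc ?_ ?_).symm
      · intro t ht
        have := abs_lt.1 (hball.1 ht)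
        constructor <;> linarith
      · rintro t ⟨⟨ht1, ht2⟩, htI⟩
        rw [hsupp, mul_zero]
        by_contra hcon
        obtain ⟨n, hn⟩ := hpar t (not_lt.1 hcon)
        rw [abs_lt] at hn
        have hn1 : (-1 : ℝ) < n := by linarith
        have hn2 : (n : ℝ) < 1 := by linarith
        have hn1' : -1 < n := by exact_mod_cast hn1
        have hn2' : n < 1 := by exact_mod_cast hn2
        have hn0 : n = 0 := by omega
        subst hn0
        refine htI (hball.2 (abs_lt.2 ?_))
        simpa using hn
    · intro t ht
      simp only [abs_of_pos (hpos t (hball.1 ht)), X', Complex.real_smul]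
      ring
  rw [HasFlux, ← hval]
  refine hlim.congr' ?_
  filter_upwards [self_mem_nhdsWithin] with ε hε using (hmain ε hε).symm

/-! ### The divergence theorem -/

lemma exists_unit_mul {w : ℂ} (hw : w ≠ 0) : ∃ e : ℂ, ‖e‖ = 1 ∧ w = (‖w‖ : ℂ) * e := by
  have h0 : (‖w‖ : ℂ) ≠ 0 := by simpa using hw
  refine ⟨w / ‖w‖, ?_, by field_simp⟩
  rw [norm_div, Complex.norm_real, norm_norm, div_self (by simpa using hw)]

/-- The integral of a directional derivative of a compactly supported function vanishes, even if the
function has a singular point `z`, provided that the derivative is integrable: almost every line in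
the direction `v` avoids `z`. -/
lemma integral_fderiv_eq_zero {F : ℂ → ℂ} {v z : ℂ} (hd : ∀ p, p ≠ z → DifferentiableAt ℝ F p)
    (hs : HasCompactSupport F) (hi : Integrable fun p => fderiv ℝ F p v) :
    ∫ p, fderiv ℝ F p v = 0 := by
  rcases eq_or_ne v 0 with rfl | hv
  · simp
  obtain ⟨e, he, hve⟩ := exists_unit_mul hv
  have hv' : (‖v‖ : ℂ) ≠ 0 := by simpa using hv
  have hsm : ∀ p, fderiv ℝ F p v = (‖v‖ : ℂ) * fderiv ℝ F p e := fun p => by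
    conv_lhs => rw [hve, ← Complex.real_smul, map_smul, Complex.real_smul]
  have hi' : Integrable fun p => fderiv ℝ F p e := by
    have := hi.const_mul (‖v‖ : ℂ)⁻¹
    simpa only [hsm, inv_mul_cancel_left₀ hv'] using this
  simp only [hsm]
  rw [integral_const_mul]
  refine mul_eq_zero_of_right _ ?_
  rw [integral_eq_integral_lines he hi', ← integral_zero ℝ ℂ]
  refine integral_congr_ae ?_
  obtain ⟨R, hR⟩ := hs.isCompact.isBounded.exists_norm_le
  have hF0 : ∀ x s : ℝ, R < |s| → F (e * (s - Complex.I * x)) = 0 := fun x s hlt => by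
    apply image_eq_zero_of_notMem_tsupport
    intro hmem
    have h1 := hR _ hmem
    rw [norm_mul, he, one_mul] at h1
    have h2 := Complex.abs_re_le_norm ((s : ℂ) - Complex.I * x)
    simp at h2
    linarith
  have hne : ∀ᵐ x : ℝ, x ≠ cross z e := by simp [ae_iff]
  filter_upwards [ae_integrable_lines he hi', hne] with x hx hxz
  have hder : ∀ s : ℝ, HasDerivAt (fun s : ℝ => F (e * (s - Complex.I * x)))
      (fderiv ℝ F (e * (s - Complex.I * x)) e) s := fun s => by
    have h1 : HasFDerivAt F (fderiv ℝ F (e * (s - Complex.I * x))) (e * (s - Complex.I * x)) := by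
      refine (hd _ fun hz => hxz ?_).hasFDerivAt
      rw [← hz, cross_mul_sub_I he]
    have h2 : HasDerivAt (fun s : ℝ => e * (s - Complex.I * x)) e s := by
      simpa using ((Complex.ofRealCLM.hasDerivAt (x := s)).sub_const (Complex.I * x)).const_mul e
    exact h1.comp_hasDerivAt s h2
  rw [integral_of_hasDerivAt_of_tendsto (m := 0) (n := 0) hder hx, sub_zero]
  · refine tendsto_const_nhds.congr' ?_
    filter_upwards [Iio_mem_atBot (-|R|)] with s hs
    rw [hF0]
    have : s < -|R| := hs
    rw [abs_of_neg (by linarith [abs_nonneg R])]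
    linarith [le_abs_self R]
  · refine tendsto_const_nhds.congr' ?_
    filter_upwards [Ioi_mem_atTop |R|] with s hs
    rw [hF0]
    have : |R| < s := hs
    rw [abs_of_pos (by linarith [abs_nonneg R])]
    linarith [le_abs_self R]

lemma continuous_boundary_trace (hγ : IsSmoothJordanBoundary Ω γ) {g : ℂ → ℂ}
    (hg : ContinuousOn g (frontier Ω)) : Continuous fun t => g (γ t) :=
  hg.comp_continuous hγ.continuous hγ.mem_frontier

lemma continuous_cross_mul (hγ : IsSmoothJordanBoundary Ω γ) {g : ℂ → ℂ} (v : ℂ)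
    (hg : ContinuousOn g (frontier Ω)) :
    Continuous fun t => (cross (deriv γ t) v : ℂ) * g (γ t) :=
  (Complex.continuous_ofReal.comp ((continuous_cross v).comp hγ.continuous_deriv)).mul
    (continuous_boundary_trace hγ hg)

lemma HasFlux.smul_dir {v : ℂ} {g : ℂ → ℂ} (h : HasFlux Ω γ v g) (c : ℝ) :
    HasFlux Ω γ (c * v) g := by
  have h1 : ∀ ε, ∫ p in innerPart Ω ε, fderiv ℝ g p (c * v) =
      c * ∫ p in innerPart Ω ε, fderiv ℝ g p v := fun ε => by
    rw [← integral_const_mul]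
    congr 1; ext p
    rw [← Complex.real_smul, map_smul, Complex.real_smul]
  have h2 : -∫ t in (0 : ℝ)..1, (cross (deriv γ t) (c * v) : ℂ) * g (γ t) =
      c * -∫ t in (0 : ℝ)..1, (cross (deriv γ t) v : ℂ) * g (γ t) := by
    rw [mul_neg, ← intervalIntegral.integral_const_mul]
    congr 2; ext t
    rw [cross_smul_right]; push_cast; ring
  rw [HasFlux, h2]
  simp only [h1]
  exact h.const_mul _

lemma HasFlux.add_dir (hγ : IsSmoothJordanBoundary Ω γ) {v w : ℂ} {g : ℂ → ℂ}
    (hgc : ContinuousOn g (frontier Ω))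
    (hiv : ∀ ε, 0 < ε → IntegrableOn (fun p => fderiv ℝ g p v) (innerPart Ω ε))
    (hiw : ∀ ε, 0 < ε → IntegrableOn (fun p => fderiv ℝ g p w) (innerPart Ω ε))
    (hv : HasFlux Ω γ v g) (hw : HasFlux Ω γ w g) : HasFlux Ω γ (v + w) g := by
  have h2 : -∫ t in (0 : ℝ)..1, (cross (deriv γ t) (v + w) : ℂ) * g (γ t) =
      (-∫ t in (0 : ℝ)..1, (cross (deriv γ t) v : ℂ) * g (γ t)) +
      -∫ t in (0 : ℝ)..1, (cross (deriv γ t) w : ℂ) * g (γ t) := by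
    rw [← neg_add, ← intervalIntegral.integral_add
      ((continuous_cross_mul hγ v hgc).intervalIntegrable _ _)
      ((continuous_cross_mul hγ w hgc).intervalIntegrable _ _)]
    congr 2; ext t
    rw [cross_add_right]; push_cast; ring
  rw [HasFlux, h2]
  refine (hv.add hw).congr' ?_
  filter_upwards [self_mem_nhdsWithin] with ε hε
  rw [← integral_add (hiv ε hε) (hiw ε hε)]
  simp only [map_add]

/-- Fluxes add up. The derivatives need to add up off one point only. -/
lemma HasFlux.add_of_eq (hγ : IsSmoothJordanBoundary Ω γ) (hΩ : IsOpen Ω) {v z : ℂ}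
    {g g₁ g₂ : ℂ → ℂ}
    (hc₁ : ContinuousOn g₁ (frontier Ω)) (hc₂ : ContinuousOn g₂ (frontier Ω))
    (hi₁ : ∀ ε, 0 < ε → IntegrableOn (fun p => fderiv ℝ g₁ p v) (innerPart Ω ε))
    (hi₂ : ∀ ε, 0 < ε → IntegrableOn (fun p => fderiv ℝ g₂ p v) (innerPart Ω ε))
    (h₁ : HasFlux Ω γ v g₁) (h₂ : HasFlux Ω γ v g₂)
    (hd₁ : ∀ p ∈ Ω, p ≠ z → DifferentiableAt ℝ g₁ p)
    (hd₂ : ∀ p ∈ Ω, p ≠ z → DifferentiableAt ℝ g₂ p)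
    (hg : ∀ p, g p = g₁ p + g₂ p) :
    HasFlux Ω γ v g ∧ ∀ ε, 0 < ε → IntegrableOn (fun p => fderiv ℝ g p v) (innerPart Ω ε) := by
  have h2 : -∫ t in (0 : ℝ)..1, (cross (deriv γ t) v : ℂ) * g (γ t) =
      (-∫ t in (0 : ℝ)..1, (cross (deriv γ t) v : ℂ) * g₁ (γ t)) +
      -∫ t in (0 : ℝ)..1, (cross (deriv γ t) v : ℂ) * g₂ (γ t) := by
    rw [← neg_add, ← intervalIntegral.integral_add
      ((continuous_cross_mul hγ v hc₁).intervalIntegrable _ _)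
      ((continuous_cross_mul hγ v hc₂).intervalIntegrable _ _)]
    congr 2; ext t
    rw [hg]; ring
  have hae : ∀ ε, (fun p => fderiv ℝ g₁ p v + fderiv ℝ g₂ p v) =ᵐ[volume.restrict (innerPart Ω ε)]
      fun p => fderiv ℝ g p v := fun ε => by
    have hne : ∀ᵐ p : ℂ ∂volume.restrict (innerPart Ω ε), p ≠ z :=
      ae_restrict_of_ae (by simp [ae_iff])
    filter_upwards [hne, ae_restrict_mem (isOpen_innerPart hΩ ε).measurableSet] with p hp hpε
    have : g = fun p => g₁ p + g₂ p := funext hg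
    rw [this, fderiv_fun_add (hd₁ p hpε.1 hp) (hd₂ p hpε.1 hp), add_apply]
  constructor
  · rw [HasFlux, h2]
    refine (h₁.add h₂).congr' ?_
    filter_upwards [self_mem_nhdsWithin] with ε hε
    rw [← integral_add (hi₁ ε hε) (hi₂ ε hε)]
    exact integral_congr_ae (hae ε)
  · exact fun ε hε => ((hi₁ ε hε).add (hi₂ ε hε)).congr (hae ε)

/-- A function with compact support in `Ω` has no flux, even if it is singular at one point. -/
lemma hasFlux_of_hasCompactSupport (hγ : IsSmoothJordanBoundary Ω γ) (hΩ : IsOpen Ω) {v z : ℂ}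
    {g : ℂ → ℂ} (hd : ∀ p, p ≠ z → DifferentiableAt ℝ g p) (hs : HasCompactSupport g)
    (hsΩ : tsupport g ⊆ Ω) (hi : Integrable fun p => fderiv ℝ g p v) : HasFlux Ω γ v g := by
  have hne : (frontier Ω).Nonempty := ⟨_, hγ.mem_frontier 0⟩
  have h2 : -∫ t in (0 : ℝ)..1, (cross (deriv γ t) v : ℂ) * g (γ t) = 0 := by
    have : ∀ t, g (γ t) = 0 := fun t =>
      image_eq_zero_of_notMem_tsupport fun h => hγ.notMem hΩ t (hsΩ h)
    simp [this]
  rw [HasFlux, h2]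
  refine tendsto_const_nhds.congr' ?_
  filter_upwards [eventually_subset_innerPart hΩ hne hs.isCompact hsΩ] with ε hε
  rw [setIntegral_eq_integral_of_forall_compl_eq_zero, integral_fderiv_eq_zero hd hs hi]
  intro p hp
  rw [image_eq_zero_of_notMem_tsupport (f := fderiv ℝ g)
    (fun h => hp (hε (tsupport_fderiv_subset ℝ h)))]
  simp

/-- A function which vanishes near the boundary has no flux. -/
lemma hasFlux_of_eq_zero (hγ : IsSmoothJordanBoundary Ω γ) (hΩ : IsOpen Ω)
    (hb : Bornology.IsBounded Ω) {v : ℂ} {g : ℂ → ℂ} (hg : ContDiffOn ℝ 1 g Ω) {U : Set ℂ}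
    (hU : IsOpen U) (hfU : frontier Ω ⊆ U) (hgU : ∀ p ∈ U, g p = 0) : HasFlux Ω γ v g := by
  set K := closure Ω \ U
  have hK : IsCompact K := hb.isCompact_closure.diff hU
  have hKΩ : K ⊆ Ω := fun p hp => by
    by_contra hcon
    exact hp.2 (hfU (by rw [hΩ.frontier_eq]; exact ⟨hp.1, hcon⟩))
  set G := Ω.indicator g
  have hGs : tsupport G ⊆ K := by
    refine closure_minimal (fun p hp => ?_) hK.isClosed
    have hpΩ : p ∈ Ω := by
      by_contra hcon
      exact hp (indicator_of_notMem hcon _)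
    refine ⟨subset_closure hpΩ, fun hpU => hp ?_⟩
    exact (indicator_of_mem hpΩ g).trans (hgU p hpU)
  have hGeq : ∀ p ∈ Ω, G =ᶠ[𝓝 p] g := fun p hp => by
    filter_upwards [hΩ.mem_nhds hp] with q hq using indicator_of_mem hq _
  have hGd : ContDiff ℝ 1 G := by
    rw [contDiff_iff_contDiffAt]
    intro p
    by_cases hp : p ∈ Ω
    · exact (hg.contDiffAt (hΩ.mem_nhds hp)).congr_of_eventuallyEq (hGeq p hp)
    · have : G =ᶠ[𝓝 p] fun _ => 0 :=
        notMem_tsupport_iff_eventuallyEq.1 fun h => hp (hKΩ (hGs h))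
      exact contDiffAt_const.congr_of_eventuallyEq this
  have hGc : HasCompactSupport G := hK.of_isClosed_subset (isClosed_tsupport _) hGs
  have hflux : HasFlux Ω γ v G := by
    refine hasFlux_of_hasCompactSupport hγ hΩ (z := 0)
      (fun p _ => hGd.differentiable (by norm_num) p) hGc (hGs.trans hKΩ) ?_
    refine Continuous.integrable_of_hasCompactSupport
      ((hGd.continuous_fderiv (by norm_num)).clm_apply continuous_const) ?_
    exact (hGc.fderiv ℝ).comp_left (g := fun L : ℂ →L[ℝ] ℂ => L v) (by simp)
  have hbd : ∀ t, g (γ t) = G (γ t) := fun t => by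
    rw [hgU _ (hfU (hγ.mem_frontier t))]
    exact (indicator_of_notMem (hγ.notMem hΩ t) g).symm
  have hin : ∀ ε, ∫ p in innerPart Ω ε, fderiv ℝ g p v = ∫ p in innerPart Ω ε, fderiv ℝ G p v :=
    fun ε => setIntegral_congr_fun (isOpen_innerPart hΩ ε).measurableSet fun p hp => by
      simp only [(hGeq p hp.1).fderiv_eq]
  rw [HasFlux] at hflux ⊢
  simpa only [hbd, hin] using hflux

/-- The divergence theorem for functions supported near a boundary point. -/
lemma exists_hasFlux (hΩ : IsOpen Ω) (hb : Bornology.IsBounded Ω)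
    (hγ : IsSmoothJordanBoundary Ω γ) (v : ℂ) (t₀ : ℝ) :
    ∃ r > 0, ∀ g : ℂ → ℂ, ContDiffOn ℝ 1 g Ω → ContinuousOn g (closure Ω) →
      (∀ p, r < ‖p - γ t₀‖ → g p = 0) → HasFlux Ω γ v g := by
  set n := Complex.I * deriv γ t₀ with hn
  have hd0 := norm_pos_iff.2 (hγ.deriv_ne_zero t₀)
  have hn0 : n ≠ 0 := mul_ne_zero Complex.I_ne_zero (hγ.deriv_ne_zero t₀)
  -- `v` is a difference of two directions to the left of the curve
  set N : ℝ := (|cross (deriv γ t₀) v| + 1) / ‖deriv γ t₀‖ ^ 2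
  set w := v + N * n
  have hw : 0 < cross (deriv γ t₀) w := by
    rw [cross_add_right, cross_smul_right, hn, cross_I_mul_self, div_mul_cancel₀ _ (by positivity)]
    linarith [neg_abs_le (cross (deriv γ t₀) v)]
  have hw0 : w ≠ 0 := by
    intro h0
    rw [h0] at hw
    simp [cross] at hw
  have hleft : ∀ w : ℂ, w ≠ 0 → 0 < cross (deriv γ t₀) w → ∃ r > 0, ∀ g : ℂ → ℂ,
      ContDiffOn ℝ 1 g Ω → ContinuousOn g (closure Ω) →
      (∀ p, r < ‖p - γ t₀‖ → g p = 0) → HasFlux Ω γ w g := fun w hw0 hw => by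
    obtain ⟨e, he, hwe⟩ := exists_unit_mul hw0
    have hpos : 0 < cross (deriv γ t₀) e := by
      rw [hwe, cross_smul_right] at hw
      exact pos_of_mul_pos_right hw (norm_nonneg _)
    obtain ⟨r, hr, h⟩ := exists_hasFlux_of_unit hΩ hb hγ he hpos
    refine ⟨r, hr, fun g h1 h2 h3 => ?_⟩
    rw [hwe]
    exact (h g h1 h2 h3).smul_dir _
  obtain ⟨r₁, hr₁, h₁⟩ := hleft w hw0 hw
  obtain ⟨r₂, hr₂, h₂⟩ := hleft n hn0 (by rw [hn, cross_I_mul_self]; positivity)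
  refine ⟨min r₁ r₂, lt_min hr₁ hr₂, fun g hg hgc hsupp => ?_⟩
  have hi : ∀ u ε, 0 < ε → IntegrableOn (fun p => fderiv ℝ g p u) (innerPart Ω ε) :=
    fun u ε hε => integrableOn_innerPart hΩ hb hε (continuousOn_fderiv_apply hΩ hg u)
  have := HasFlux.add_dir hγ (hgc.mono frontier_subset_closure) (hi _) (hi _)
    (h₁ g hg hgc fun p hp => hsupp p ((min_le_left _ _).trans_lt hp))
    ((h₂ g hg hgc fun p hp => hsupp p ((min_le_right _ _).trans_lt hp)).smul_dir (-N))
  convert this using 1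
  simp only [w]; push_cast; ring

/-- **Divergence theorem** for a bounded open set with `C¹` boundary, the domain integral being
exhausted by the inner parts. -/
theorem hasFlux (hΩ : IsOpen Ω) (hb : Bornology.IsBounded Ω)
    (hγ : IsSmoothJordanBoundary Ω γ) (v : ℂ) {g : ℂ → ℂ} (hg : ContDiffOn ℝ 1 g Ω)
    (hgc : ContinuousOn g (closure Ω)) : HasFlux Ω γ v g := by
  choose r hr h using exists_hasFlux hΩ hb hγ v
  have hcpt : IsCompact (frontier Ω) := hb.isCompact_closure.of_isClosed_subset isClosed_frontier
    frontier_subset_closure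
  obtain ⟨s, hs⟩ := hcpt.elim_finite_subcover (fun t => Metric.ball (γ t) (r t / 2))
    (fun t => Metric.isOpen_ball) (by
      rw [hγ.frontier_eq]
      rintro _ ⟨t, rfl⟩
      exact mem_iUnion.2 ⟨t, Metric.mem_ball_self (half_pos (hr t))⟩)
  set f : ∀ t, ContDiffBump (γ t) := fun t => ⟨r t / 2, r t, half_pos (hr t), half_lt_self (hr t)⟩
  set χ : ℝ → ℂ → ℂ := fun t p => (f t p : ℂ)
  have hχ : ∀ t, ContDiff ℝ 1 (χ t) := fun t =>
    Complex.ofRealCLM.contDiff.comp ((f t).contDiff (n := 1))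
  have key : ∀ s : Finset ℝ, ∀ g : ℂ → ℂ, ContDiffOn ℝ 1 g Ω → ContinuousOn g (closure Ω) →
      HasFlux Ω γ v (fun p => g p * ∏ t ∈ s, (1 - χ t p)) → HasFlux Ω γ v g := by
    intro s
    induction s using Finset.induction_on with
    | empty => intro g _ _ h; simpa using h
    | insert t s ht ih =>
      intro g hg hgc hflux
      have hg₁ : ContDiffOn ℝ 1 (fun p => g p * (1 - χ t p)) Ω :=
        hg.mul (contDiff_const.sub (hχ t)).contDiffOn
      have hc₁ : ContinuousOn (fun p => g p * (1 - χ t p)) (closure Ω) :=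
        hgc.mul (continuous_const.sub (hχ t).continuous).continuousOn
      have hg₂ : ContDiffOn ℝ 1 (fun p => g p * χ t p) Ω := hg.mul (hχ t).contDiffOn
      have hc₂ : ContinuousOn (fun p => g p * χ t p) (closure Ω) :=
        hgc.mul (hχ t).continuous.continuousOn
      have h₁ := ih _ hg₁ hc₁ (by
        simpa only [Finset.prod_insert ht, mul_assoc] using hflux)
      have h₂ := h t _ hg₂ hc₂ (fun p hp => by
        simp only [χ]
        rw [(f t).zero_of_le_dist (by rw [dist_eq_norm]; exact hp.le)]; simp)
      exact (HasFlux.add_of_eq hγ hΩ (z := 0) (hc₁.mono frontier_subset_closure)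
        (hc₂.mono frontier_subset_closure)
        (fun ε hε => integrableOn_innerPart hΩ hb hε (continuousOn_fderiv_apply hΩ hg₁ v))
        (fun ε hε => integrableOn_innerPart hΩ hb hε (continuousOn_fderiv_apply hΩ hg₂ v)) h₁ h₂
        (fun p hp _ => (hg₁.differentiableOn (by norm_num)).differentiableAt (hΩ.mem_nhds hp))
        (fun p hp _ => (hg₂.differentiableOn (by norm_num)).differentiableAt (hΩ.mem_nhds hp))
        (fun p => by ring)).1
  refine key s g hg hgc (hasFlux_of_eq_zero hγ hΩ hb ?_
    (isOpen_biUnion fun t (_ : t ∈ s) => Metric.isOpen_ball) hs fun p hp => ?_)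
  · exact hg.mul (contDiff_prod fun t _ => contDiff_const.sub (hχ t)).contDiffOn
  · obtain ⟨t, ht, hpt⟩ := mem_iUnion₂.1 hp
    rw [Finset.prod_eq_zero ht, mul_zero]
    simp only [χ]
    rw [(f t).one_of_mem_closedBall (Metric.ball_subset_closedBall hpt)]; simp

/-! ### The Cauchy kernel -/

lemma integrableOn_inv_norm_sub (z : ℂ) (r : ℝ) :
    IntegrableOn (fun p : ℂ => ‖p - z‖⁻¹) (Metric.ball z r) := by
  have h0 : IntegrableOn (fun p : ℂ => ‖p‖⁻¹) (Metric.ball 0 r) := by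
    refine (integrableOn_fun_norm_addHaar (E := ℂ) volume (f := fun y => y⁻¹)).2 ?_
    refine IntegrableOn.congr_fun (f := fun _ : ℝ => (1 : ℝ)) (integrableOn_const (by simp))
      (fun y hy => ?_) measurableSet_Ioo
    simp [Complex.finrank_real_complex, mul_inv_cancel₀ hy.1.ne']
  have hmp := measurePreserving_sub_right (volume : Measure ℂ) z
  have := (hmp.integrableOn_comp_preimage (MeasurableEquiv.subRight z).measurableEmbedding).2 h0
  have hball : Metric.ball z r = (fun x => x - z) ⁻¹' Metric.ball 0 r := by
    ext p; simp only [Metric.mem_ball, mem_preimage, dist_eq_norm, sub_zero]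
  rwa [hball]

lemma integrableOn_of_norm_le {F : ℂ → ℂ} {K : Set ℂ} {z : ℂ} {C : ℝ} (hK : MeasurableSet K)
    (hKb : Bornology.IsBounded K) (hF : ContinuousOn F (K \ {z}))
    (hle : ∀ p ∈ K, p ≠ z → ‖F p‖ ≤ C * ‖p - z‖⁻¹) : IntegrableOn F K := by
  obtain ⟨r, hr⟩ := hKb.subset_ball z
  have hne : ∀ᵐ p : ℂ ∂volume.restrict K, p ≠ z := ae_restrict_of_ae (by simp [ae_iff])
  refine Integrable.mono' (((integrableOn_inv_norm_sub z r).mono_set hr).const_mul C) ?_ ?_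
  · have h1 := hF.aestronglyMeasurable (μ := volume) (hK.diff (measurableSet_singleton z))
    have : volume.restrict (K \ {z}) = volume.restrict K :=
      Measure.restrict_congr_set (sdiff_null_ae_eq_self (by simp))
    rwa [this] at h1
  · filter_upwards [hne, ae_restrict_mem hK] with p hp hpK using hle p hpK hp

section Polar

/-- In polar coordinates, `2 ∂_z̄ = e^{iθ} (∂_r + (i / r) ∂_θ)`. -/
lemma dzbar_eq_rotate (h : ℂ → ℂ) (p e : ℂ) (he : ‖e‖ = 1) :
    dzbar h p = e * (fderiv ℝ h p e + Complex.I * fderiv ℝ h p (Complex.I * e)) / 2 := by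
  have h1 : fderiv ℝ h p e = e.re * fderiv ℝ h p 1 + e.im * fderiv ℝ h p Complex.I := by
    conv_lhs => rw [show e = e.re • (1 : ℂ) + e.im • Complex.I by
      simp [Complex.re_add_im]]
    rw [map_add, map_smul, map_smul]; simp
  have h2 : fderiv ℝ h p (Complex.I * e) = -e.im * fderiv ℝ h p 1 + e.re * fderiv ℝ h p Complex.I := by
    conv_lhs => rw [show Complex.I * e = (-e.im) • (1 : ℂ) + e.re • Complex.I by
      apply Complex.ext <;> simp]
    rw [map_add, map_smul, map_smul]; simp
  have h3 : (e.re : ℂ) * e.re + e.im * e.im = 1 := by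
    have : e.re * e.re + e.im * e.im = 1 := by
      rw [← Complex.normSq_apply, Complex.normSq_eq_norm_sq, he]; norm_num
    exact_mod_cast this
  rw [h1, h2, dzbar]
  have h4 : e = e.re + e.im * Complex.I := (Complex.re_add_im e).symm
  set a := fderiv ℝ h p 1
  set b := fderiv ℝ h p Complex.I
  generalize (e.re : ℂ) = x at *
  generalize (e.im : ℂ) = y at *
  rw [h4]
  linear_combination (-(a + Complex.I * b) / 2) * h3 +
    ((y * y * a - y * x * b) / 2) * Complex.I_sq

/-- The unit vector of argument `θ`. -/
noncomputable def unitVec (θ : ℝ) : ℂ := Real.cos θ + Real.sin θ * Complex.I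

lemma unitVec_eq_exp (θ : ℝ) : unitVec θ = Complex.exp (θ * Complex.I) := by
  rw [Complex.exp_mul_I, unitVec]; push_cast; rfl

lemma norm_unitVec (θ : ℝ) : ‖unitVec θ‖ = 1 := by
  rw [unitVec_eq_exp, Complex.norm_exp_ofReal_mul_I]

lemma hasDerivAt_unitVec (θ : ℝ) : HasDerivAt unitVec (Complex.I * unitVec θ) θ := by
  have h1 : HasDerivAt (fun θ : ℝ => Complex.exp (θ * Complex.I))
      (Complex.exp (θ * Complex.I) * Complex.I) θ := by
    simpa using ((Complex.ofRealCLM.hasDerivAt (x := θ)).mul_const Complex.I).cexp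
  have h2 : unitVec = fun θ : ℝ => Complex.exp (θ * Complex.I) := funext unitVec_eq_exp
  rw [h2, mul_comm]; exact h1

lemma continuous_unitVec : Continuous unitVec := by unfold unitVec; fun_prop

/-- The **Cauchy-Pompeiu formula** for a function with compact support, centred at `0`. -/
lemma integral_dzbar_div_self {h : ℂ → ℂ} (hh : ContDiff ℝ 1 h) (hs : HasCompactSupport h) :
    ∫ p, dzbar h p / p = -Real.pi * h 0 := by
  obtain ⟨R, hR0, hR⟩ : ∃ R > 0, ∀ p, R ≤ ‖p‖ → h p = 0 ∧ fderiv ℝ h p = 0 := by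
    obtain ⟨R, hR⟩ := hs.isCompact.isBounded.exists_norm_le
    refine ⟨|R| + 1, by positivity, fun p hp => ?_⟩
    have hn : p ∉ tsupport h := fun hmem => by
      have := hR p hmem
      linarith [le_abs_self R]
    exact ⟨image_eq_zero_of_notMem_tsupport hn,
      image_eq_zero_of_notMem_tsupport fun hmem => hn (tsupport_fderiv_subset ℝ hmem)⟩
  have hd : ∀ p, HasFDerivAt h (fderiv ℝ h p) p := fun p =>
    (hh.differentiable (by norm_num) p).hasFDerivAt
  have hdc : Continuous (fderiv ℝ h) := hh.continuous_fderiv (by norm_num)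
  set A : ℝ × ℝ → ℂ := fun q => fderiv ℝ h (q.1 * unitVec q.2) (unitVec q.2)
  set B : ℝ × ℝ → ℂ := fun q => fderiv ℝ h (q.1 * unitVec q.2) (Complex.I * unitVec q.2)
  have hu := continuous_unitVec
  have hA : Continuous A := (hdc.comp (by fun_prop)).clm_apply (by fun_prop)
  have hB : Continuous B := (hdc.comp (by fun_prop)).clm_apply (by fun_prop)
  set Q : Set (ℝ × ℝ) := Ioc 0 R ×ˢ Ioo (-Real.pi) Real.pi
  have hint : ∀ F : ℝ × ℝ → ℂ, Continuous F → IntegrableOn F Q (volume.prod volume) := fun F hF =>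
    (hF.continuousOn.integrableOn_compact (isCompact_Icc.prod isCompact_Icc)).mono_set
      (prod_mono Ioc_subset_Icc_self Ioo_subset_Icc_self)
  have hpi : -Real.pi ≤ Real.pi := by linarith [Real.pi_pos]
  -- radial part
  have hIA : ∫ q in Q, A q ∂(volume.prod volume) = -(2 * Real.pi) * h 0 := by
    have hi := hint A hA
    rw [← setIntegral_prod_swap, setIntegral_prod]
    · have : ∀ θ : ℝ, ∫ r in Ioc 0 R, A (r, θ) = -h 0 := fun θ => by
        rw [← intervalIntegral.integral_of_le hR0.le,
          intervalIntegral.integral_eq_sub_of_hasDerivAt (f := fun r : ℝ => h (r * unitVec θ))]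
        · rw [(hR _ _).1]
          · simp
          · rw [norm_mul, norm_unitVec, Complex.norm_real, mul_one, Real.norm_eq_abs]
            exact le_abs_self R
        · intro r _
          refine (hd _).comp_hasDerivAt r ?_
          simpa using (Complex.ofRealCLM.hasDerivAt (x := r)).mul_const (unitVec θ)
        · exact (hA.comp (by fun_prop : Continuous fun r : ℝ => (r, θ))).intervalIntegrable _ _
      simp only [Prod.swap_prod_mk, this]
      rw [setIntegral_const]
      simp only [measureReal_def, Real.volume_Ioo]
      rw [ENNReal.toReal_ofReal (by linarith), Complex.real_smul]
      push_cast; ring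
    · exact (hA.comp continuous_swap).continuousOn.integrableOn_compact
        (isCompact_Icc.prod isCompact_Icc) |>.mono_set
          (prod_mono Ioo_subset_Icc_self Ioc_subset_Icc_self)
  -- angular part
  have hIB : ∫ q in Q, B q ∂(volume.prod volume) = 0 := by
    rw [setIntegral_prod _ (hint B hB)]
    rw [setIntegral_congr_fun measurableSet_Ioc (g := fun _ => 0), integral_zero]
    intro r hr
    simp only
    rw [← integral_Ioc_eq_integral_Ioo, ← intervalIntegral.integral_of_le hpi]
    have h1 : ∀ θ : ℝ, HasDerivAt (fun θ : ℝ => h (r * unitVec θ)) (r * B (r, θ)) θ := fun θ => by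
      have h2 := (hd (r * unitVec θ)).comp_hasDerivAt θ ((hasDerivAt_unitVec θ).const_mul (r : ℂ))
      have h6 : ∀ (L : ℂ →L[ℝ] ℂ) (w : ℂ), L ((r : ℂ) * w) = r * L w := fun L w => by
        rw [← Complex.real_smul, map_smul, Complex.real_smul]
      rwa [h6] at h2
    have h3 := intervalIntegral.integral_eq_sub_of_hasDerivAt (a := -Real.pi) (b := Real.pi)
      (fun θ _ => h1 θ)
      ((continuous_const.mul
        (hB.comp (by fun_prop : Continuous fun θ : ℝ => (r, θ)))).intervalIntegrable _ _)
    rw [intervalIntegral.integral_const_mul] at h3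
    have h4 : (r : ℂ) ≠ 0 := by exact_mod_cast hr.1.ne'
    have h5 : unitVec Real.pi = unitVec (-Real.pi) := by simp [unitVec]
    rw [h5, sub_self] at h3
    exact (mul_eq_zero.1 h3).resolve_left h4
  rw [← Complex.integral_comp_polarCoord_symm, show (-Real.pi * h 0 : ℂ) =
    ∫ q in Q, (A q + Complex.I * B q) / 2 ∂(volume.prod volume) by
      rw [integral_div, integral_add (hint A hA) ((hint B hB).const_mul _), integral_const_mul,
        hIA, hIB]
      ring]
  have hpolar : ∀ q, Complex.polarCoord.symm q = q.1 * unitVec q.2 := fun q => by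
    rw [Complex.polarCoord_symm_apply, unitVec]
  rw [← Measure.volume_eq_prod]
  rw [← setIntegral_eq_of_subset_of_forall_sdiff_eq_zero polarCoord.open_target.measurableSet
    (s := Q) (t := polarCoord.target)]
  · refine setIntegral_congr_fun polarCoord.open_target.measurableSet fun q hq => ?_
    have hr : (q.1 : ℂ) ≠ 0 := by exact_mod_cast (show (0 : ℝ) < q.1 from hq.1).ne'
    have hu0 : unitVec q.2 ≠ 0 := by
      rw [← norm_pos_iff, norm_unitVec]; exact one_pos
    simp only [hpolar, Complex.real_smul, A, B]
    rw [dzbar_eq_rotate h _ _ (norm_unitVec q.2)]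
    field_simp
  · exact fun q hq => ⟨hq.1.1, hq.2⟩
  · intro q hq
    have hq1 : R < q.1 := by
      by_contra hcon
      exact hq.2 ⟨⟨hq.1.1, not_lt.1 hcon⟩, hq.1.2⟩
    have : fderiv ℝ h (q.1 * unitVec q.2) = 0 := (hR _ (by
      rw [norm_mul, norm_unitVec, Complex.norm_real, mul_one, Real.norm_eq_abs]
      exact hq1.le.trans (le_abs_self _))).2
    simp [A, B, this]

end Polar

/-! ### Complex derivatives -/

section Wirtinger
variable {f g : ℂ → ℂ} {p : ℂ}

lemma dz_mul (hf : DifferentiableAt ℝ f p) (hg : DifferentiableAt ℝ g p) :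
    dz (fun q => f q * g q) p = f p * dz g p + dz f p * g p := by
  simp only [dz, fderiv_fun_mul hf hg, add_apply, smul_apply, smul_eq_mul]; ring

lemma dzbar_mul (hf : DifferentiableAt ℝ f p) (hg : DifferentiableAt ℝ g p) :
    dzbar (fun q => f q * g q) p = f p * dzbar g p + dzbar f p * g p := by
  simp only [dzbar, fderiv_fun_mul hf hg, add_apply, smul_apply, smul_eq_mul]; ring

lemma dz_add (hf : DifferentiableAt ℝ f p) (hg : DifferentiableAt ℝ g p) :
    dz (fun q => f q + g q) p = dz f p + dz g p := by
  simp only [dz, fderiv_fun_add hf hg, add_apply]; ring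

lemma dzbar_add (hf : DifferentiableAt ℝ f p) (hg : DifferentiableAt ℝ g p) :
    dzbar (fun q => f q + g q) p = dzbar f p + dzbar g p := by
  simp only [dzbar, fderiv_fun_add hf hg, add_apply]; ring

lemma dz_const_mul (c : ℂ) (hf : DifferentiableAt ℝ f p) :
    dz (fun q => c * f q) p = c * dz f p := by
  simp only [dz, fderiv_const_mul hf, smul_apply, smul_eq_mul]; ring

lemma dzbar_const_mul (c : ℂ) (hf : DifferentiableAt ℝ f p) :
    dzbar (fun q => c * f q) p = c * dzbar f p := by
  simp only [dzbar, fderiv_const_mul hf, smul_apply, smul_eq_mul]; ring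

lemma dz_congr (h : f =ᶠ[𝓝 p] g) : dz f p = dz g p := by
  simp only [dz, h.fderiv_eq]

lemma dzbar_congr (h : f =ᶠ[𝓝 p] g) : dzbar f p = dzbar g p := by
  simp only [dzbar, h.fderiv_eq]

lemma fderiv_conj_comp (hf : DifferentiableAt ℝ f p) (v : ℂ) :
    fderiv ℝ (fun q => conj (f q)) p v = conj (fderiv ℝ f p v) := by
  have h1 := (Complex.conjCLE : ℂ ≃L[ℝ] ℂ).hasFDerivAt.comp p hf.hasFDerivAt
  have h2 : HasFDerivAt (fun q => conj (f q))
    ((Complex.conjCLE : ℂ →L[ℝ] ℂ).comp (fderiv ℝ f p)) p := h1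
  rw [h2.fderiv]; simp

lemma dz_conj (hf : DifferentiableAt ℝ f p) :
    dz (fun q => conj (f q)) p = conj (dzbar f p) := by
  have h2 : conj (2 : ℂ) = 2 := map_ofNat _ 2
  simp only [dz, dzbar, fderiv_conj_comp hf]
  simp [h2]; ring

lemma dzbar_conj (hf : DifferentiableAt ℝ f p) :
    dzbar (fun q => conj (f q)) p = conj (dz f p) := by
  have h2 : conj (2 : ℂ) = 2 := map_ofNat _ 2
  simp only [dz, dzbar, fderiv_conj_comp hf]
  simp [h2]

/-- Wirtinger derivatives can be read off a formula for the real derivative. -/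
lemma dz_eq_of_fderiv {a b : ℂ} (h : ∀ v, fderiv ℝ f p v = a * v + b * conj v) : dz f p = a := by
  rw [dz, h, h]; simp; linear_combination (-(a + -b) / 2) * Complex.I_sq

lemma dzbar_eq_of_fderiv {a b : ℂ} (h : ∀ v, fderiv ℝ f p v = a * v + b * conj v) :
    dzbar f p = b := by
  rw [dzbar, h, h]; simp; linear_combination ((a - b) / 2) * Complex.I_sq

lemma hasDerivAt_line (p v : ℂ) : HasDerivAt (fun s : ℝ => p + s * v) v 0 := by
  simpa using ((Complex.ofRealCLM.hasDerivAt (x := 0)).mul_const v).const_add p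

lemma fderiv_apply_of_hasDerivAt {v d : ℂ} (hf : DifferentiableAt ℝ f p)
    (h : HasDerivAt (fun s : ℝ => f (p + s * v)) d 0) : fderiv ℝ f p v = d := by
  have h2 : HasFDerivAt f (fderiv ℝ f p) (p + ((0 : ℝ) : ℂ) * v) := by
    simpa using hf.hasFDerivAt
  exact (h2.comp_hasDerivAt 0 (hasDerivAt_line p v)).unique h

end Wirtinger

/-! ### The kernels of the formula -/

section Kernels
variable {z p : ℂ}

lemma contDiff_conj {n : WithTop ℕ∞} : ContDiff ℝ n (fun q : ℂ => conj q) :=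
  (Complex.conjCLE : ℂ ≃L[ℝ] ℂ).contDiff

lemma conj_sub_ne_zero (h : p ≠ z) : conj (p - z) ≠ 0 :=
  (map_ne_zero _).2 (sub_ne_zero.2 h)

lemma contDiffAt_quotKernel {n : WithTop ℕ∞} (h : p ≠ z) : ContDiffAt ℝ n (quotKernel z) p := by
  have h1 : quotKernel z = fun q => (q - z) * (conj (q - z))⁻¹ :=
    funext fun q => div_eq_mul_inv _ _
  rw [h1]
  exact (contDiff_id.sub contDiff_const).contDiffAt.mul
    ((contDiff_conj.comp (contDiff_id.sub contDiff_const)).contDiffAt.inv (conj_sub_ne_zero h))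

lemma contDiffAt_logKernel {n : WithTop ℕ∞} (h : p ≠ z) : ContDiffAt ℝ n (logKernel z) p := by
  refine Complex.ofRealCLM.contDiff.contDiffAt.comp p (ContDiffAt.log ?_ ?_)
  · exact ((contDiff_norm_sq ℝ).comp (contDiff_id.sub contDiff_const)).contDiffAt
  · have := norm_pos_iff.2 (sub_ne_zero.2 h)
    positivity

lemma contDiffAt_inv_sub {n : WithTop ℕ∞} (h : p ≠ z) :
    ContDiffAt ℝ n (fun q => (q - z)⁻¹) p :=
  (contDiff_id.sub contDiff_const).contDiffAt.inv (sub_ne_zero.2 h)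

lemma fderiv_inv_sub (h : p ≠ z) (v : ℂ) :
    fderiv ℝ (fun q => (q - z)⁻¹) p v = -((p - z) ^ 2)⁻¹ * v + 0 * conj v := by
  refine fderiv_apply_of_hasDerivAt ((contDiffAt_inv_sub (n := 1) h).differentiableAt (by norm_num)) ?_
  have h0 := sub_ne_zero.2 h
  have := ((hasDerivAt_line p v).sub_const z).inv (by simpa using h0)
  refine this.congr_deriv ?_
  simp; field_simp

lemma fderiv_quotKernel (h : p ≠ z) (v : ℂ) :
    fderiv ℝ (quotKernel z) p v =
      (conj (p - z))⁻¹ * v + -((p - z) / conj (p - z) ^ 2) * conj v := by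
  refine fderiv_apply_of_hasDerivAt ((contDiffAt_quotKernel (n := 1) h).differentiableAt (by norm_num)) ?_
  have h0 := conj_sub_ne_zero h
  have h1 := (hasDerivAt_line p v).sub_const z
  have h2 : HasDerivAt (fun s : ℝ => conj (p + s * v - z)) (conj v) 0 :=
    (Complex.conjCLE : ℂ →L[ℝ] ℂ).hasFDerivAt.comp_hasDerivAt 0 h1
  have := h1.div h2 (by simpa using h0)
  refine this.congr_deriv ?_
  simp only [Complex.ofReal_zero, zero_mul, add_zero]
  field_simp
  ring

lemma fderiv_logKernel (h : p ≠ z) (v : ℂ) :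
    fderiv ℝ (logKernel z) p v = (p - z)⁻¹ * v + (conj (p - z))⁻¹ * conj v := by
  refine fderiv_apply_of_hasDerivAt ((contDiffAt_logKernel (n := 1) h).differentiableAt (by norm_num)) ?_
  have h0 := sub_ne_zero.2 h
  have h0' := conj_sub_ne_zero h
  have h1 := (hasDerivAt_line p v).sub_const z
  have h2 : HasDerivAt (fun s : ℝ => conj (p + s * v - z)) (conj v) 0 :=
    (Complex.conjCLE : ℂ →L[ℝ] ℂ).hasFDerivAt.comp_hasDerivAt 0 h1
  have h3 := Complex.reCLM.hasFDerivAt.comp_hasDerivAt (0 : ℝ) (h1.mul h2)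
  have h4 : HasDerivAt (fun s : ℝ => ‖p + s * v - z‖ ^ 2)
      (v * conj (p - z) + (p - z) * conj v).re 0 := by
    have h8 : (fun s : ℝ => ‖p + s * v - z‖ ^ 2) = Complex.reCLM ∘
        ((fun s : ℝ => p + s * v - z) * fun s : ℝ => conj (p + s * v - z)) := by
      ext s
      simp only [Function.comp_apply, Complex.reCLM_apply, Pi.mul_apply, Complex.mul_conj,
        Complex.normSq_eq_norm_sq, Complex.ofReal_re]
    rw [h8]
    exact h3.congr_deriv (by simp)
  have h5 := (h4.log (by simpa using h0)).ofReal_comp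
  refine h5.congr_deriv ?_
  have h6 : ((v * conj (p - z) + (p - z) * conj v).re : ℂ) =
      v * conj (p - z) + (p - z) * conj v := by
    rw [← Complex.conj_eq_iff_re]; simp; ring
  have h7 : ((‖p - z‖ ^ 2 : ℝ) : ℂ) = (p - z) * conj (p - z) := by
    rw [Complex.mul_conj, Complex.normSq_eq_norm_sq]
  simp only [Complex.ofReal_zero, zero_mul, add_zero]
  rw [Complex.ofReal_div, h6, h7]
  field_simp

lemma norm_quotKernel_le : ‖quotKernel z p‖ ≤ 1 := by
  rw [quotKernel, norm_div, Complex.norm_conj]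
  exact div_self_le_one _

lemma norm_logKernel_le (h : p ≠ z) (h1 : ‖p - z‖ ≤ 1) : ‖logKernel z p‖ ≤ 2 * ‖p - z‖⁻¹ := by
  have h0 := norm_pos_iff.2 (sub_ne_zero.2 h)
  have := (Real.abs_log_mul_self_lt _ h0 h1).le
  rw [abs_mul, abs_of_pos h0] at this
  rw [logKernel, Complex.norm_real, Real.norm_eq_abs, Real.log_pow, abs_mul]
  simp only [Nat.cast_ofNat, Nat.abs_ofNat]
  refine mul_le_mul_of_nonneg_left ?_ (by norm_num)
  rwa [← one_div, le_div_iff₀ h0]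

lemma norm_fderiv_quotKernel_le (h : p ≠ z) (v : ℂ) :
    ‖fderiv ℝ (quotKernel z) p v‖ ≤ 2 * ‖v‖ * ‖p - z‖⁻¹ := by
  have h0 := norm_pos_iff.2 (sub_ne_zero.2 h)
  rw [fderiv_quotKernel h]
  refine (norm_add_le _ _).trans (le_of_eq ?_)
  simp only [norm_mul, norm_inv, norm_neg, norm_div, norm_pow, Complex.norm_conj]
  field_simp; ring

lemma norm_fderiv_logKernel_le (h : p ≠ z) (v : ℂ) :
    ‖fderiv ℝ (logKernel z) p v‖ ≤ 2 * ‖v‖ * ‖p - z‖⁻¹ := by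
  rw [fderiv_logKernel h]
  refine (norm_add_le _ _).trans (le_of_eq ?_)
  simp only [norm_mul, norm_inv, Complex.norm_conj]
  ring

end Kernels

/-! ### Complex form of the divergence theorem -/

/-- The divergence theorem holds for `g v`, for all constant directions `v`. -/
structure SatisfiesStokes (Ω : Set ℂ) (γ : ℝ → ℂ) (g : ℂ → ℂ) : Prop where
  continuousOn : ContinuousOn g (frontier Ω)
  integrableOn : ∀ v ε, 0 < ε → IntegrableOn (fun p => fderiv ℝ g p v) (innerPart Ω ε)
  hasFlux : ∀ v, HasFlux Ω γ v g

lemma satisfiesStokes (hΩ : IsOpen Ω) (hb : Bornology.IsBounded Ω)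
    (hγ : IsSmoothJordanBoundary Ω γ) {g : ℂ → ℂ} (hg : ContDiffOn ℝ 1 g Ω)
    (hgc : ContinuousOn g (closure Ω)) : SatisfiesStokes Ω γ g :=
  ⟨hgc.mono frontier_subset_closure,
    fun v _ hε => integrableOn_innerPart hΩ hb hε (continuousOn_fderiv_apply hΩ hg v),
    fun v => hasFlux hΩ hb hγ v hg hgc⟩

namespace SatisfiesStokes
variable {g : ℂ → ℂ}

lemma integrableOn_dzbar (h : SatisfiesStokes Ω γ g) {ε : ℝ} (hε : 0 < ε) :
    IntegrableOn (dzbar g) (innerPart Ω ε) :=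
  ((h.integrableOn 1 ε hε).add ((h.integrableOn Complex.I ε hε).const_mul Complex.I)).div_const 2

lemma integrableOn_dz (h : SatisfiesStokes Ω γ g) {ε : ℝ} (hε : 0 < ε) :
    IntegrableOn (dz g) (innerPart Ω ε) :=
  ((h.integrableOn 1 ε hε).sub ((h.integrableOn Complex.I ε hε).const_mul Complex.I)).div_const 2

lemma intervalIntegrable (hγ : IsSmoothJordanBoundary Ω γ) (h : SatisfiesStokes Ω γ g) (v : ℂ) :
    IntervalIntegrable (fun t => (cross (deriv γ t) v : ℂ) * g (γ t)) volume 0 1 :=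
  (continuous_cross_mul hγ v h.continuousOn).intervalIntegrable _ _

lemma tendsto_dzbar (hγ : IsSmoothJordanBoundary Ω γ) (h : SatisfiesStokes Ω γ g) :
    Tendsto (fun ε : ℝ => ∫ p in innerPart Ω ε, dzbar g p) (𝓝[>] 0)
      (𝓝 (formIntegral γ g (fun _ => 0) / (2 * Complex.I))) := by
  have h1 := ((h.hasFlux 1).add ((h.hasFlux Complex.I).const_mul Complex.I)).div_const 2
  have hval : (-(∫ t in (0 : ℝ)..1, (cross (deriv γ t) 1 : ℂ) * g (γ t)) + Complex.I *
      -∫ t in (0 : ℝ)..1, (cross (deriv γ t) Complex.I : ℂ) * g (γ t)) / 2 =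
      formIntegral γ g (fun _ => 0) / (2 * Complex.I) := by
    rw [eq_div_iff (by simp), formIntegral, mul_neg, ← intervalIntegral.integral_const_mul,
      ← neg_add, ← intervalIntegral.integral_add (h.intervalIntegrable hγ 1)
        ((h.intervalIntegrable hγ Complex.I).const_mul _), ← intervalIntegral.integral_neg,
      ← intervalIntegral.integral_div, ← intervalIntegral.integral_mul_const]
    congr 1; ext t
    simp [cross]
    linear_combination -(((deriv γ t).re : ℂ) * g (γ t)) * Complex.I_sq +
      g (γ t) * Complex.re_add_im (deriv γ t)
  rw [hval] at h1
  refine h1.congr' ?_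
  filter_upwards [self_mem_nhdsWithin] with ε hε
  rw [← integral_const_mul, ← integral_add (h.integrableOn 1 ε hε)
    ((h.integrableOn Complex.I ε hε).const_mul _), ← integral_div]
  rfl

lemma tendsto_dz (hγ : IsSmoothJordanBoundary Ω γ) (h : SatisfiesStokes Ω γ g) :
    Tendsto (fun ε : ℝ => ∫ p in innerPart Ω ε, dz g p) (𝓝[>] 0)
      (𝓝 (-formIntegral γ (fun _ => 0) g / (2 * Complex.I))) := by
  have h1 := ((h.hasFlux 1).sub ((h.hasFlux Complex.I).const_mul Complex.I)).div_const 2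
  have hval : (-(∫ t in (0 : ℝ)..1, (cross (deriv γ t) 1 : ℂ) * g (γ t)) - Complex.I *
      -∫ t in (0 : ℝ)..1, (cross (deriv γ t) Complex.I : ℂ) * g (γ t)) / 2 =
      -formIntegral γ (fun _ => 0) g / (2 * Complex.I) := by
    rw [eq_div_iff (by simp), formIntegral, mul_neg, ← intervalIntegral.integral_const_mul,
      sub_neg_eq_add, neg_add_eq_sub,
      ← intervalIntegral.integral_sub ((h.intervalIntegrable hγ Complex.I).const_mul _)
        (h.intervalIntegrable hγ 1), ← intervalIntegral.integral_neg,
      ← intervalIntegral.integral_div, ← intervalIntegral.integral_mul_const]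
    congr 1; ext t
    have hc : ((deriv γ t).re : ℂ) - (deriv γ t).im * Complex.I = conj (deriv γ t) := by
      apply Complex.ext <;> simp
    simp [cross]
    linear_combination (((deriv γ t).re : ℂ) * g (γ t)) * Complex.I_sq - g (γ t) * hc
  rw [hval] at h1
  refine h1.congr' ?_
  filter_upwards [self_mem_nhdsWithin] with ε hε
  rw [← integral_const_mul, ← integral_sub (h.integrableOn 1 ε hε)
    ((h.integrableOn Complex.I ε hε).const_mul _), ← integral_div]
  rfl

end SatisfiesStokes

/-! ### Singular integrands and the Cauchy-Pompeiu formula -/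

lemma exists_cutoff {z : ℂ} {N : Set ℂ} (hN : N ∈ 𝓝 z) :
    ∃ χ : ℂ → ℂ, ContDiff ℝ 1 χ ∧ HasCompactSupport χ ∧ tsupport χ ⊆ N ∧
      χ =ᶠ[𝓝 z] fun _ => 1 := by
  obtain ⟨r, hr, hrN⟩ := Metric.nhds_basis_closedBall.mem_iff.1 hN
  set f : ContDiffBump z := ⟨r / 2, r, half_pos hr, half_lt_self hr⟩
  have hsup : tsupport (fun p => (f p : ℂ)) ⊆ Metric.closedBall z r := by
    have h2 : Function.support (fun p => (f p : ℂ)) = Function.support f := by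
      ext p; simp [Function.mem_support]
    have h1 : tsupport (fun p => (f p : ℂ)) = tsupport f := by rw [tsupport, h2, tsupport]
    rw [h1, f.tsupport_eq]
  refine ⟨fun p => (f p : ℂ), Complex.ofRealCLM.contDiff.comp (f.contDiff (n := 1)),
    (isCompact_closedBall z r).of_isClosed_subset (isClosed_tsupport _) hsup, hsup.trans hrN, ?_⟩
  filter_upwards [f.eventuallyEq_one] with p hp
  simp [hp]

section Cutoff
variable {z : ℂ} {χ g : ℂ → ℂ}

lemma contDiffOn_cutoff_compl (hΩ : IsOpen Ω) (hχ : ContDiff ℝ 1 χ)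
    (hχ1 : χ =ᶠ[𝓝 z] fun _ => 1) (hg : ContDiffOn ℝ 1 g (Ω \ {z})) :
    ContDiffOn ℝ 1 (fun p => (1 - χ p) * g p) Ω := by
  intro p hp
  refine ContDiffAt.contDiffWithinAt ?_
  rcases eq_or_ne p z with rfl | hpz
  · refine (contDiffAt_const (c := (0 : ℂ))).congr_of_eventuallyEq ?_
    filter_upwards [hχ1] with q hq using by simp [hq]
  · exact (contDiff_const.sub hχ).contDiffAt.mul
      (hg.contDiffAt ((hΩ.sdiff isClosed_singleton).mem_nhds ⟨hp, hpz⟩))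

lemma continuousOn_cutoff_compl (hχ : ContDiff ℝ 1 χ)
    (hχ1 : χ =ᶠ[𝓝 z] fun _ => 1) (hg : ContinuousOn g (closure Ω \ {z})) :
    ContinuousOn (fun p => (1 - χ p) * g p) (closure Ω) := by
  intro p hp
  rcases eq_or_ne p z with rfl | hpz
  · refine ContinuousAt.continuousWithinAt
      ((continuousAt_const (y := (0 : ℂ))).congr_of_eventuallyEq ?_)
    filter_upwards [hχ1] with q hq using by simp [hq]
  · have h1 : ContinuousWithinAt g (closure Ω) p :=
      (hg p ⟨hp, hpz⟩).mono_of_mem_nhdsWithin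
        (inter_mem_nhdsWithin _ (isOpen_ne.mem_nhds hpz))
    exact (continuous_const.sub hχ.continuous).continuousWithinAt.mul h1

lemma contDiffAt_cutoff_mul (hΩ : IsOpen Ω) (hχ : ContDiff ℝ 1 χ) (hχΩ : tsupport χ ⊆ Ω)
    (hg : ContDiffOn ℝ 1 g (Ω \ {z})) {p : ℂ} (hp : p ≠ z) :
    ContDiffAt ℝ 1 (fun p => χ p * g p) p := by
  by_cases hpΩ : p ∈ Ω
  · exact hχ.contDiffAt.mul
      (hg.contDiffAt ((hΩ.sdiff isClosed_singleton).mem_nhds ⟨hpΩ, hp⟩))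
  · refine (contDiffAt_const (c := (0 : ℂ))).congr_of_eventuallyEq ?_
    filter_upwards [notMem_tsupport_iff_eventuallyEq.1 fun h => hpΩ (hχΩ h)] with q hq
    simp [hq]

end Cutoff

/-- The divergence theorem for functions singular at one point `z` of the domain, with integrable
derivatives near `z`. -/
lemma satisfiesStokes_of_singular (hΩ : IsOpen Ω) (hb : Bornology.IsBounded Ω)
    (hγ : IsSmoothJordanBoundary Ω γ) {z : ℂ} (hz : z ∈ Ω) {g : ℂ → ℂ}
    (hg : ContDiffOn ℝ 1 g (Ω \ {z})) (hgc : ContinuousOn g (closure Ω \ {z})) {N : Set ℂ}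
    (hN : N ∈ 𝓝 z) (hi : ∀ v, IntegrableOn (fun p => fderiv ℝ g p v) N) :
    SatisfiesStokes Ω γ g := by
  obtain ⟨χ, hχ, hχc, hχN, hχ1⟩ := exists_cutoff (Filter.inter_mem hN (hΩ.mem_nhds hz))
  have hχΩ := hχN.trans inter_subset_right
  have hχN' := hχN.trans inter_subset_left
  have hd₁ : ∀ p, p ≠ z → ContDiffAt ℝ 1 (fun p => χ p * g p) p :=
    fun p hp => contDiffAt_cutoff_mul hΩ hχ hχΩ hg hp
  have hs₁ : HasCompactSupport fun p => χ p * g p := hχc.mul_right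
  have ht₁ : tsupport (fun p => χ p * g p) ⊆ tsupport χ := tsupport_mul_subset_left
  have hgd : ∀ p ∈ Ω, p ≠ z → ContDiffAt ℝ 1 g p := fun p hp hpz =>
    hg.contDiffAt ((hΩ.sdiff isClosed_singleton).mem_nhds ⟨hp, hpz⟩)
  have hi₁ : ∀ v, Integrable fun p => fderiv ℝ (fun p => χ p * g p) p v := fun v => by
    -- the derivative of the cutoff vanishes near the singular point
    set H : ℂ → ℂ := fun p => g p * fderiv ℝ χ p v
    have hHs : tsupport H ⊆ tsupport χ := by
      refine closure_minimal (fun p hp => ?_) (isClosed_tsupport _)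
      by_contra hcon
      refine hp ?_
      simp only [H]
      rw [image_eq_zero_of_notMem_tsupport (f := fderiv ℝ χ)
        fun h => hcon (tsupport_fderiv_subset ℝ h)]
      simp
    have hHc : Continuous H := by
      rw [continuous_iff_continuousAt]
      intro p
      rcases eq_or_ne p z with rfl | hpz
      · refine (continuousAt_const (y := (0 : ℂ))).congr_of_eventuallyEq ?_
        filter_upwards [hχ1.eventuallyEq_nhds] with q hq
        simp [H, hq.fderiv_eq]
      · by_cases hpΩ : p ∈ Ω
        · exact (hgd p hpΩ hpz).continuousAt.mul
            ((hχ.continuous_fderiv (by norm_num)).clm_apply continuous_const).continuousAt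
        · refine (continuousAt_const (y := (0 : ℂ))).congr_of_eventuallyEq ?_
          exact notMem_tsupport_iff_eventuallyEq.1 fun h => hpΩ (hχΩ (hHs h))
    have hHi : Integrable H := hHc.integrable_of_hasCompactSupport
      (hχc.isCompact.of_isClosed_subset (isClosed_tsupport _) hHs)
    obtain ⟨C, hC⟩ := hχ.continuous.bounded_above_of_compact_support hχc
    have hGi : Integrable fun p => χ p * fderiv ℝ g p v := by
      have h1 : IntegrableOn (fun p => χ p * fderiv ℝ g p v) (tsupport χ) :=
        ((hi v).mono_set hχN').bdd_mul hχ.continuous.aestronglyMeasurable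
          (Eventually.of_forall hC)
      exact h1.integrable_of_forall_notMem_eq_zero fun p hp => by
        rw [image_eq_zero_of_notMem_tsupport hp, zero_mul]
    refine (hGi.add hHi).congr ?_
    have hne : ∀ᵐ p : ℂ, p ≠ z := by simp [ae_iff]
    filter_upwards [hne] with p hp
    by_cases hpΩ : p ∈ Ω
    · rw [fderiv_fun_mul (hχ.differentiable (by norm_num) p)
        ((hgd p hpΩ hp).differentiableAt (by norm_num))]
      simp [H]
    · have h1 : p ∉ tsupport χ := fun h => hpΩ (hχΩ h)
      have h2 : fderiv ℝ (fun p => χ p * g p) p = 0 :=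
        image_eq_zero_of_notMem_tsupport fun h => h1 (ht₁ (tsupport_fderiv_subset ℝ h))
      have h3 : H p = 0 := image_eq_zero_of_notMem_tsupport fun h => h1 (hHs h)
      simp only [Pi.add_apply, h2, h3]
      rw [image_eq_zero_of_notMem_tsupport h1]; simp
  have hg₂ := contDiffOn_cutoff_compl hΩ hχ hχ1 hg
  have hc₂ := continuousOn_cutoff_compl hχ hχ1 hgc
  have hS₂ := satisfiesStokes hΩ hb hγ hg₂ hc₂
  have hfz : z ∉ frontier Ω := fun h => by rw [hΩ.frontier_eq] at h; exact h.2 hz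
  have hsub : frontier Ω ⊆ closure Ω \ {z} := fun p hp =>
    ⟨frontier_subset_closure hp, fun h => hfz (by rwa [mem_singleton_iff.1 h] at hp)⟩
  have hc₁ : ContinuousOn (fun p => χ p * g p) (frontier Ω) :=
    hχ.continuous.continuousOn.mul (hgc.mono hsub)
  have key : ∀ v, _ := fun v => HasFlux.add_of_eq hγ hΩ (v := v) (z := z) (g := g) hc₁
    hS₂.continuousOn (fun ε hε => (hi₁ v).integrableOn) (hS₂.integrableOn v)
    (hasFlux_of_hasCompactSupport hγ hΩ
      (fun p hp => (hd₁ p hp).differentiableAt (by norm_num)) hs₁ (ht₁.trans hχΩ) (hi₁ v))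
    (hS₂.hasFlux v) (fun p _ hp => (hd₁ p hp).differentiableAt (by norm_num))
    (fun p hp _ => (hg₂.differentiableOn (by norm_num)).differentiableAt (hΩ.mem_nhds hp))
    (fun p => by ring)
  exact ⟨hgc.mono hsub, fun v => (key v).2, fun v => (key v).1⟩

/-- The divergence theorem for a product `k a` of a weakly singular kernel `k` and a function
`a`. -/
lemma satisfiesStokes_kernel_mul (hΩ : IsOpen Ω) (hb : Bornology.IsBounded Ω)
    (hγ : IsSmoothJordanBoundary Ω γ) {z : ℂ} (hz : z ∈ Ω) {k a : ℂ → ℂ}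
    (hk : ∀ p, p ≠ z → ContDiffAt ℝ 1 k p)
    (hk0 : ∀ p, p ≠ z → ‖p - z‖ ≤ 1 → ‖k p‖ ≤ 2 * ‖p - z‖⁻¹)
    (hk1 : ∀ p v, p ≠ z → ‖fderiv ℝ k p v‖ ≤ 2 * ‖v‖ * ‖p - z‖⁻¹)
    (ha : ContDiffOn ℝ 1 a Ω) (hac : ContinuousOn a (closure Ω)) :
    SatisfiesStokes Ω γ (fun p => k p * a p) := by
  have hg : ContDiffOn ℝ 1 (fun p => k p * a p) (Ω \ {z}) := fun p hp =>
    ((hk p hp.2).mul (ha.contDiffAt (hΩ.mem_nhds hp.1))).contDiffWithinAt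
  have hgc : ContinuousOn (fun p => k p * a p) (closure Ω \ {z}) := fun p hp =>
    (hk p hp.2).continuousAt.continuousWithinAt.mul ((hac p hp.1).mono sdiff_subset)
  obtain ⟨r, hr, hrΩ⟩ := Metric.nhds_basis_closedBall.mem_iff.1 (hΩ.mem_nhds hz)
  set K := Metric.closedBall z (min r 1)
  have hKΩ : K ⊆ Ω := (Metric.closedBall_subset_closedBall (min_le_left _ _)).trans hrΩ
  have hK : IsCompact K := isCompact_closedBall _ _
  refine satisfiesStokes_of_singular hΩ hb hγ hz hg hgc
    (Metric.closedBall_mem_nhds z (lt_min hr one_pos)) fun v => ?_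
  obtain ⟨A, hA⟩ := hK.exists_bound_of_continuousOn (ha.continuousOn.mono hKΩ)
  obtain ⟨B, hB⟩ := hK.exists_bound_of_continuousOn ((continuousOn_fderiv_apply hΩ ha v).mono hKΩ)
  refine integrableOn_of_norm_le (z := z) (C := 2 * B + 2 * ‖v‖ * A) hK.measurableSet
    hK.isBounded ?_ fun p hp hpz => ?_
  · exact (continuousOn_fderiv_apply (hΩ.sdiff isClosed_singleton) hg v).mono
      (sdiff_subset_sdiff_left hKΩ)
  · have hp1 : ‖p - z‖ ≤ 1 := by
      rw [← dist_eq_norm]; exact (Metric.mem_closedBall.1 hp).trans (min_le_right _ _)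
    rw [fderiv_fun_mul ((hk p hpz).differentiableAt (by norm_num))
      ((ha.contDiffAt (hΩ.mem_nhds (hKΩ hp))).differentiableAt (by norm_num))]
    simp only [add_apply, smul_apply, smul_eq_mul]
    refine (norm_add_le _ _).trans ?_
    rw [norm_mul, norm_mul, add_mul]
    refine add_le_add ?_ ?_
    · calc ‖k p‖ * ‖fderiv ℝ a p v‖ ≤ (2 * ‖p - z‖⁻¹) * B :=
            mul_le_mul (hk0 p hpz hp1) (hB p hp) (norm_nonneg _) (by positivity)
        _ = 2 * B * ‖p - z‖⁻¹ := by ring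
    · calc ‖a p‖ * ‖fderiv ℝ k p v‖ ≤ A * (2 * ‖v‖ * ‖p - z‖⁻¹) :=
            mul_le_mul (hA p hp) (hk1 p v hpz) (norm_nonneg _)
              ((norm_nonneg _).trans (hA p hp))
        _ = 2 * ‖v‖ * A * ‖p - z‖⁻¹ := by ring

lemma satisfiesStokes_quotKernel_mul (hΩ : IsOpen Ω) (hb : Bornology.IsBounded Ω)
    (hγ : IsSmoothJordanBoundary Ω γ) {z : ℂ} (hz : z ∈ Ω) {a : ℂ → ℂ}
    (ha : ContDiffOn ℝ 1 a Ω) (hac : ContinuousOn a (closure Ω)) :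
    SatisfiesStokes Ω γ (fun p => quotKernel z p * a p) :=
  satisfiesStokes_kernel_mul hΩ hb hγ hz (fun _ hp => contDiffAt_quotKernel hp)
    (fun p hp hp1 => norm_quotKernel_le.trans (by
      have := (one_le_inv₀ (norm_pos_iff.2 (sub_ne_zero.2 hp))).2 hp1
      linarith))
    (fun _ v hp => norm_fderiv_quotKernel_le hp v) ha hac

lemma satisfiesStokes_logKernel_mul (hΩ : IsOpen Ω) (hb : Bornology.IsBounded Ω)
    (hγ : IsSmoothJordanBoundary Ω γ) {z : ℂ} (hz : z ∈ Ω) {a : ℂ → ℂ}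
    (ha : ContDiffOn ℝ 1 a Ω) (hac : ContinuousOn a (closure Ω)) :
    SatisfiesStokes Ω γ (fun p => logKernel z p * a p) :=
  satisfiesStokes_kernel_mul hΩ hb hγ hz (fun _ hp => contDiffAt_logKernel hp)
    (fun _ hp hp1 => norm_logKernel_le hp hp1)
    (fun _ v hp => norm_fderiv_logKernel_le hp v) ha hac

lemma integral_dzbar_div_sub {h : ℂ → ℂ} (hh : ContDiff ℝ 1 h) (hs : HasCompactSupport h) (z : ℂ) :
    ∫ p, dzbar h p / (p - z) = -Real.pi * h z := by
  have h1 := integral_dzbar_div_self (h := fun p => h (p + z))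
    (hh.comp (contDiff_id.add contDiff_const)) (hs.comp_homeomorph (Homeomorph.addRight z))
  rw [zero_add] at h1
  rw [← h1, ← integral_add_right_eq_self _ z]
  congr 1; ext p
  simp only [dzbar, fderiv_comp_add_right, add_sub_cancel_right]

lemma dzbar_div_sub {h : ℂ → ℂ} {z p : ℂ} (hh : DifferentiableAt ℝ h p) (hp : p ≠ z) :
    dzbar (fun q => h q / (q - z)) p = dzbar h p / (p - z) := by
  have h1 : (fun q => h q / (q - z)) = fun q => h q * (q - z)⁻¹ := funext fun q => div_eq_mul_inv _ _
  rw [h1, dzbar_mul hh ((contDiffAt_inv_sub (n := 1) hp).differentiableAt (by norm_num)),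
    dzbar_eq_of_fderiv (fderiv_inv_sub hp), mul_zero, zero_add, div_eq_mul_inv]

lemma continuousOn_dzbar (hΩ : IsOpen Ω) {f : ℂ → ℂ} (hf : ContDiffOn ℝ 1 f Ω) :
    ContinuousOn (dzbar f) Ω :=
  ((continuousOn_fderiv_apply hΩ hf 1).add
    (continuousOn_const.mul (continuousOn_fderiv_apply hΩ hf Complex.I))).div_const 2

/-- The **Cauchy-Pompeiu formula**: the area integral of `∂_z̄ f / (ξ - z)` over the inner parts
converges. -/
theorem tendsto_integral_dzbar_div (hΩ : IsOpen Ω) (hb : Bornology.IsBounded Ω)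
    (hγ : IsSmoothJordanBoundary Ω γ) {z : ℂ} (hz : z ∈ Ω) {f : ℂ → ℂ}
    (hf : ContDiffOn ℝ 1 f Ω) (hfc : ContinuousOn f (closure Ω)) :
    (∀ ε, 0 < ε → IntegrableOn (fun p => dzbar f p / (p - z)) (innerPart Ω ε)) ∧
    Tendsto (fun ε : ℝ => ∫ p in innerPart Ω ε, dzbar f p / (p - z)) (𝓝[>] 0)
      (𝓝 (formIntegral γ (fun ξ => f ξ / (ξ - z)) (fun _ => 0) / (2 * Complex.I)
        - Real.pi * f z)) := by
  obtain ⟨χ, hχ, hχc, hχΩ, hχ1⟩ := exists_cutoff (hΩ.mem_nhds hz)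
  have hne : (frontier Ω).Nonempty := ⟨_, hγ.mem_frontier 0⟩
  set g : ℂ → ℂ := fun p => f p / (p - z)
  have hg : ContDiffOn ℝ 1 g (Ω \ {z}) := fun p hp => by
    simp only [g, div_eq_mul_inv]
    exact ((hf.contDiffAt (hΩ.mem_nhds hp.1)).mul (contDiffAt_inv_sub hp.2)).contDiffWithinAt
  have hgc : ContinuousOn g (closure Ω \ {z}) := fun p hp =>
    ((hfc p hp.1).mono sdiff_subset).div (by fun_prop) (sub_ne_zero.2 hp.2)
  have hS := satisfiesStokes hΩ hb hγ (contDiffOn_cutoff_compl hΩ hχ hχ1 hg)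
    (continuousOn_cutoff_compl hχ hχ1 hgc)
  have hh : ContDiff ℝ 1 fun p => χ p * f p := by
    rw [contDiff_iff_contDiffAt]
    intro p
    by_cases hpΩ : p ∈ Ω
    · exact hχ.contDiffAt.mul (hf.contDiffAt (hΩ.mem_nhds hpΩ))
    · refine (contDiffAt_const (c := (0 : ℂ))).congr_of_eventuallyEq ?_
      filter_upwards [notMem_tsupport_iff_eventuallyEq.1 fun h => hpΩ (hχΩ h)] with q hq
      simp [hq]
  have hs : HasCompactSupport fun p => χ p * f p := hχc.mul_right
  have hts : tsupport (fun p => χ p * f p) ⊆ tsupport χ := tsupport_mul_subset_left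
  set G : ℂ → ℂ := fun p => dzbar (fun q => χ q * f q) p / (p - z)
  have hG0 : ∀ p, p ∉ tsupport χ → G p = 0 := fun p hp => by
    have : fderiv ℝ (fun q => χ q * f q) p = 0 :=
      image_eq_zero_of_notMem_tsupport fun h => hp (hts (tsupport_fderiv_subset ℝ h))
    simp [G, dzbar, this]
  have hdc : Continuous (dzbar fun q => χ q * f q) := by
    rw [← continuousOn_univ]
    exact continuousOn_dzbar isOpen_univ hh.contDiffOn
  have hGi : Integrable G := by
    obtain ⟨C, hC⟩ := hχc.isCompact.exists_bound_of_continuousOn hdc.continuousOn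
    refine IntegrableOn.integrable_of_forall_notMem_eq_zero (s := tsupport χ) ?_ hG0
    refine integrableOn_of_norm_le (z := z) (C := C) (isClosed_tsupport χ).measurableSet
      hχc.isCompact.isBounded ?_ fun p hp hpz => ?_
    · exact hdc.continuousOn.div (continuousOn_id.sub continuousOn_const)
        fun p hp => sub_ne_zero.2 hp.2
    · simp only [G]
      rw [norm_div, div_eq_mul_inv]
      exact mul_le_mul_of_nonneg_right (hC p hp) (by positivity)
  have hGval : ∫ p, G p = -Real.pi * f z := by
    rw [integral_dzbar_div_sub hh hs z, hχ1.self_of_nhds, one_mul]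
  have hae : ∀ ε, (fun p => dzbar (fun q => (1 - χ q) * g q) p + G p)
      =ᵐ[volume.restrict (innerPart Ω ε)] fun p => dzbar f p / (p - z) := fun ε => by
    have hnez : ∀ᵐ p : ℂ ∂volume.restrict (innerPart Ω ε), p ≠ z :=
      ae_restrict_of_ae (by simp [ae_iff])
    filter_upwards [hnez, ae_restrict_mem (isOpen_innerPart hΩ ε).measurableSet] with p hp hpε
    have hfd : DifferentiableAt ℝ f p :=
      (hf.differentiableOn (by norm_num)).differentiableAt (hΩ.mem_nhds hpε.1)
    have hχd : DifferentiableAt ℝ χ p := hχ.differentiable (by norm_num) p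
    have h1 : (fun q => (1 - χ q) * g q) = fun q => ((1 - χ q) * f q) / (q - z) :=
      funext fun q => by simp only [g]; ring
    have hcd : DifferentiableAt ℝ (fun q => 1 - χ q) p := hχd.const_sub 1
    have h2 : DifferentiableAt ℝ (fun q => (1 - χ q) * f q) p := hcd.mul hfd
    have h3 : DifferentiableAt ℝ (fun q => χ q * f q) p := hχd.mul hfd
    rw [h1, dzbar_div_sub h2 hp]
    simp only [G]
    rw [← add_div, ← dzbar_add h2 h3]
    congr 2; ext q; ring
  refine ⟨fun ε hε => ((hS.integrableOn_dzbar hε).add hGi.integrableOn).congr (hae ε), ?_⟩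
  have hform : formIntegral γ (fun q => (1 - χ q) * g q) (fun _ => 0) =
      formIntegral γ g (fun _ => 0) := by
    simp only [formIntegral]
    congr 1; ext t
    rw [image_eq_zero_of_notMem_tsupport fun h => hγ.notMem hΩ t (hχΩ h)]; simp
  have hlim := hS.tendsto_dzbar hγ
  rw [hform] at hlim
  have := hlim.add (tendsto_const_nhds (x := -Real.pi * f z))
  rw [sub_eq_add_neg, ← neg_mul]
  refine this.congr' ?_
  filter_upwards [self_mem_nhdsWithin,
    eventually_subset_innerPart hΩ hne hχc.isCompact hχΩ] with ε hε hsub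
  rw [← integral_congr_ae (hae ε), integral_add (hS.integrableOn_dzbar hε) hGi.integrableOn,
    setIntegral_eq_integral_of_forall_compl_eq_zero (f := G)
      fun p hp => hG0 p fun h => hp (hsub h), hGval]

/-- The conjugate Cauchy-Pompeiu formula. -/
theorem tendsto_integral_dz_div_conj (hΩ : IsOpen Ω) (hb : Bornology.IsBounded Ω)
    (hγ : IsSmoothJordanBoundary Ω γ) {z : ℂ} (hz : z ∈ Ω) {f : ℂ → ℂ}
    (hf : ContDiffOn ℝ 1 f Ω) (hfc : ContinuousOn f (closure Ω)) :
    (∀ ε, 0 < ε → IntegrableOn (fun p => dz f p / conj (p - z)) (innerPart Ω ε)) ∧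
    Tendsto (fun ε : ℝ => ∫ p in innerPart Ω ε, dz f p / conj (p - z)) (𝓝[>] 0)
      (𝓝 (-formIntegral γ (fun _ => 0) (fun ξ => f ξ / conj (ξ - z)) / (2 * Complex.I)
        - Real.pi * f z)) := by
  obtain ⟨hi, hl⟩ := tendsto_integral_dzbar_div hΩ hb hγ hz (f := conjFun f)
    (contDiff_conj.comp_contDiffOn hf) (Complex.continuous_conj.comp_continuousOn hfc)
  have heq : ∀ p ∈ Ω, conj (dzbar (conjFun f) p / (p - z)) = dz f p / conj (p - z) :=
    fun p hp => by
      have : dzbar (conjFun f) p = conj (dz f p) := dzbar_conj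
        ((hf.differentiableOn (by norm_num)).differentiableAt (hΩ.mem_nhds hp))
      rw [this, map_div₀, Complex.conj_conj]
  constructor
  · intro ε hε
    refine IntegrableOn.congr_fun ?_ (fun p hp => heq p hp.1) (isOpen_innerPart hΩ ε).measurableSet
    exact (Complex.conjCLE : ℂ →L[ℝ] ℂ).integrable_comp (hi ε hε)
  · have h1 := (Complex.continuous_conj.tendsto _).comp hl
    have h2 : conj (formIntegral γ (fun ξ => conjFun f ξ / (ξ - z)) (fun _ => 0)) =
        formIntegral γ (fun _ => 0) (fun ξ => f ξ / conj (ξ - z)) := by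
      simp only [formIntegral]
      rw [← intervalIntegral.intervalIntegral_conj]
      congr 1; ext t
      simp [conjFun]
    rw [map_sub, map_div₀, h2] at h1
    convert h1 using 1
    · ext ε
      rw [Function.comp_apply, ← integral_conj]
      exact setIntegral_congr_fun (isOpen_innerPart hΩ ε).measurableSet
        fun p hp => (heq p hp.1).symm
    · have h3 : conj (2 : ℂ) = 2 := map_ofNat _ 2
      simp [conjFun, h3, neg_div, div_neg]

/-! ### The representation formula -/

section Extension
variable {F E : ℂ → ℂ}

lemma continuousOn_extendFrom_of_eqOn (hE : ContinuousOn E (closure Ω)) (h : EqOn E F Ω) :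
    ContinuousOn (extendFrom Ω F) (closure Ω) :=
  continuousOn_extendFrom subset_rfl fun x hx => ⟨E x,
    ((hE x hx).mono subset_closure).tendsto.congr' (h.eventuallyEq_of_mem self_mem_nhdsWithin)⟩

lemma extendFrom_eqOn (hF : ContinuousOn F Ω) : EqOn (extendFrom Ω F) F Ω :=
  fun x hx => extendFrom_eq (subset_closure hx) (hF x hx)

end Extension

section SecondDerivatives
variable {f : ℂ → ℂ}

lemma contDiffOn_fderiv_apply (hΩ : IsOpen Ω) (hf : ContDiffOn ℝ 2 f Ω) (v : ℂ) :
    ContDiffOn ℝ 1 (fun p => fderiv ℝ f p v) Ω :=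
  (hf.fderiv_of_isOpen hΩ (by norm_num)).clm_apply contDiffOn_const

lemma contDiffOn_dz (hΩ : IsOpen Ω) (hf : ContDiffOn ℝ 2 f Ω) : ContDiffOn ℝ 1 (dz f) Ω :=
  ((contDiffOn_fderiv_apply hΩ hf 1).sub
    (contDiffOn_const.mul (contDiffOn_fderiv_apply hΩ hf Complex.I))).div_const 2

lemma contDiffOn_dzbar (hΩ : IsOpen Ω) (hf : ContDiffOn ℝ 2 f Ω) : ContDiffOn ℝ 1 (dzbar f) Ω :=
  ((contDiffOn_fderiv_apply hΩ hf 1).add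
    (contDiffOn_const.mul (contDiffOn_fderiv_apply hΩ hf Complex.I))).div_const 2

lemma dz_dzbar_comm (hΩ : IsOpen Ω) (hf : ContDiffOn ℝ 2 f Ω) {p : ℂ} (hp : p ∈ Ω) :
    dz (dzbar f) p = dzbar (dz f) p := by
  have hfp : ContDiffAt ℝ 2 f p := hf.contDiffAt (hΩ.mem_nhds hp)
  have hd : ∀ v, DifferentiableAt ℝ (fun q => fderiv ℝ f q v) p := fun v =>
    ((contDiffOn_fderiv_apply hΩ hf v).differentiableOn (by norm_num)).differentiableAt
      (hΩ.mem_nhds hp)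
  have hsymm : ∀ v w, fderiv ℝ (fun q => fderiv ℝ f q v) p w =
      fderiv ℝ (fun q => fderiv ℝ f q w) p v := fun v w => by
    have hdd : DifferentiableAt ℝ (fderiv ℝ f) p :=
      (hfp.fderiv_right (m := 1) (by norm_num)).differentiableAt (by norm_num)
    have h1 : ∀ v w, fderiv ℝ (fun q => fderiv ℝ f q v) p w = fderiv ℝ (fderiv ℝ f) p w v :=
      fun v w => by
        rw [fderiv_clm_apply hdd (differentiableAt_const v)]; simp
    rw [h1, h1]
    exact (hfp.isSymmSndFDerivAt (by simp)) w v
  have h1 : ∀ c : ℂ, HasFDerivAt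
      (fun q => (fderiv ℝ f q 1 + c * fderiv ℝ f q Complex.I) / 2)
      ((2⁻¹ : ℂ) • (fderiv ℝ (fun q => fderiv ℝ f q 1) p +
        c • fderiv ℝ (fun q => fderiv ℝ f q Complex.I) p)) p := fun c => by
    have := ((hd 1).hasFDerivAt.add ((hd Complex.I).hasFDerivAt.const_mul c)).const_mul (2⁻¹ : ℂ)
    refine this.congr_of_eventuallyEq (Eventually.of_forall fun q => ?_)
    simp only [Pi.add_apply]; ring
  have h2 : fderiv ℝ (dzbar f) p = _ := (h1 Complex.I).fderiv
  have h4 : dz f = fun q => (fderiv ℝ f q 1 + -Complex.I * fderiv ℝ f q Complex.I) / 2 := by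
    ext q; simp only [dz]; ring
  have h3 := (h1 (-Complex.I)).fderiv
  rw [← h4] at h3
  rw [dz, dzbar, h2, h3]
  simp only [add_apply, smul_apply, smul_eq_mul]
  rw [hsymm 1 Complex.I]
  ring

end SecondDerivatives

section Pointwise
variable {f : ℂ → ℂ} {z p : ℂ}

lemma dzbar_conjFun_eqOn (hΩ : IsOpen Ω) (hf : ContDiffOn ℝ 1 f Ω) :
    EqOn (dzbar (conjFun f)) (fun q => conj (dz f q)) Ω := fun _ hp =>
  dzbar_conj ((hf.differentiableOn (by norm_num)).differentiableAt (hΩ.mem_nhds hp))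

lemma conj_lame (hΩ : IsOpen Ω) (hf : ContDiffOn ℝ 2 f Ω) (hp : p ∈ Ω) (α β : ℝ) :
    conj (lame α β f p) = α * dz (dz f) p + β * dz (dzbar (conjFun f)) p := by
  have hev : dzbar (conjFun f) =ᶠ[𝓝 p] fun q => conj (dz f q) :=
    (dzbar_conjFun_eqOn hΩ (hf.of_le (by norm_num))).eventuallyEq_of_mem (hΩ.mem_nhds hp)
  have hd : DifferentiableAt ℝ (dz f) p :=
    ((contDiffOn_dz hΩ hf).differentiableOn (by norm_num)).differentiableAt (hΩ.mem_nhds hp)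
  rw [lame, dzbar_congr hev, dz_congr hev, dzbar_conj hd, dz_conj hd]
  simp

/-- Off the singular point, the domain integrand is a combination of complex derivatives and of
Cauchy kernels. The first derivatives of `f` multiplied by `1 / conj (ξ - z)` that come from the
two kernels cancel because `α* β = β* α`. -/
lemma domainIntegrand_eq (hΩ : IsOpen Ω) (hf : ContDiffOn ℝ 2 f Ω) (hp : p ∈ Ω) (hpz : p ≠ z)
    (α β : ℝ) {u w s : ℂ → ℂ} (hu : EqOn u (dz f) Ω) (hw : EqOn w (dzbar (conjFun f)) Ω)
    (hs : EqOn s (dzbar f) Ω) :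
    domainIntegrand α β f z p =
      alphaStar α β * dz (fun q => quotKernel z q * (α * u q + β * w q)) p
      - betaStar α β * dzbar (fun q => logKernel z q * (α * w q)) p
      - betaStar α β * dz (fun q => logKernel z q * (β * s q)) p
      - (α * alphaStar α β) * (dz f p / conj (p - z))
      + (β * betaStar α β) * (dzbar f p / (p - z)) := by
  have hnhds := hΩ.mem_nhds hp
  have hu' := hu.eventuallyEq_of_mem hnhds
  have hw' := hw.eventuallyEq_of_mem hnhds
  have hs' := hs.eventuallyEq_of_mem hnhds
  have hfc : ContDiffOn ℝ 2 (conjFun f) Ω := contDiff_conj.comp_contDiffOn hf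
  have hud : DifferentiableAt ℝ u p :=
    (((contDiffOn_dz hΩ hf).differentiableOn (by norm_num)).differentiableAt
      hnhds).congr_of_eventuallyEq hu'
  have hwd : DifferentiableAt ℝ w p :=
    (((contDiffOn_dzbar hΩ hfc).differentiableOn (by norm_num)).differentiableAt
      hnhds).congr_of_eventuallyEq hw'
  have hsd : DifferentiableAt ℝ s p :=
    (((contDiffOn_dzbar hΩ hf).differentiableOn (by norm_num)).differentiableAt
      hnhds).congr_of_eventuallyEq hs'
  have hK : DifferentiableAt ℝ (quotKernel z) p :=
    (contDiffAt_quotKernel (n := 1) hpz).differentiableAt (by norm_num)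
  have hL : DifferentiableAt ℝ (logKernel z) p :=
    (contDiffAt_logKernel (n := 1) hpz).differentiableAt (by norm_num)
  have hαu : DifferentiableAt ℝ (fun q => (α : ℂ) * u q) p := hud.const_mul _
  have hβw : DifferentiableAt ℝ (fun q => (β : ℂ) * w q) p := hwd.const_mul _
  have hαw : DifferentiableAt ℝ (fun q => (α : ℂ) * w q) p := hwd.const_mul _
  have hβs : DifferentiableAt ℝ (fun q => (β : ℂ) * s q) p := hsd.const_mul _
  have huw : DifferentiableAt ℝ (fun q => (α : ℂ) * u q + β * w q) p := hαu.add hβw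
  rw [dz_mul hK huw, dz_add hαu hβw, dz_const_mul _ hud, dz_const_mul _ hwd,
    dzbar_mul hL hαw, dzbar_const_mul _ hwd, dz_mul hL hβs, dz_const_mul _ hsd,
    dz_eq_of_fderiv (fderiv_quotKernel hpz), dz_eq_of_fderiv (fderiv_logKernel hpz),
    dzbar_eq_of_fderiv (fderiv_logKernel hpz), dz_congr hu', dz_congr hw', dzbar_congr hw',
    dz_congr hs', hu hp, hw hp, hs hp, dz_dzbar_comm hΩ hf hp, domainIntegrand,
    conj_lame hΩ hf hp, lame]
  have hcancel : (alphaStar α β : ℂ) * β = betaStar α β * α := by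
    rw [alphaStar, betaStar]; push_cast; ring
  linear_combination -((conj (p - z))⁻¹ * dzbar (conjFun f) p) * hcancel

end Pointwise

lemma tendsto_integral_innerPart (hΩ : IsOpen Ω) (hne : (frontier Ω).Nonempty) {F : ℂ → ℂ}
    (hF : IntegrableOn F Ω) :
    Tendsto (fun ε : ℝ => ∫ p in innerPart Ω ε, F p) (𝓝[>] 0) (𝓝 (∫ p in Ω, F p)) := by
  have hcov : AECover (volume.restrict Ω) (𝓝[>] (0 : ℝ)) (innerPart Ω) :=
    ⟨by filter_upwards [ae_restrict_mem hΩ.measurableSet] with p hp using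
      eventually_mem_innerPart hΩ hne hp, fun ε => (isOpen_innerPart hΩ ε).measurableSet⟩
  have := hcov.integral_tendsto_of_countably_generated hF
  refine this.congr fun ε => ?_
  rw [Measure.restrict_restrict (isOpen_innerPart hΩ ε).measurableSet,
    inter_eq_left.2 (innerPart_subset ε)]

lemma formIntegral_neg_eq_sub (hγ : IsSmoothJordanBoundary Ω γ) {a b : ℂ → ℂ}
    (ha : ContinuousOn a (frontier Ω)) (hb : ContinuousOn b (frontier Ω)) :
    formIntegral γ a (fun ξ => -b ξ) =
      formIntegral γ a (fun _ => 0) - formIntegral γ (fun _ => 0) b := by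
  have h1 : Continuous fun t => a (γ t) * deriv γ t + 0 * conj (deriv γ t) :=
    ((continuous_boundary_trace hγ ha).mul hγ.continuous_deriv).add
      (continuous_const.mul (Complex.continuous_conj.comp hγ.continuous_deriv))
  have h2 : Continuous fun t => 0 * deriv γ t + b (γ t) * conj (deriv γ t) :=
    (continuous_const.mul hγ.continuous_deriv).add ((continuous_boundary_trace hγ hb).mul
      (Complex.continuous_conj.comp hγ.continuous_deriv))
  simp only [formIntegral]
  rw [← intervalIntegral.integral_sub (h1.intervalIntegrable _ _) (h2.intervalIntegrable _ _)]
  congr 1; ext t; ring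

/-- The representation formula for an arbitrary bounded domain with `C¹` boundary, and arbitrary
real coefficients with `α² ≠ β²`. -/
theorem borelPompeiu {α β : ℝ} (hαβ : α ^ 2 - β ^ 2 ≠ 0) (hΩ : IsOpen Ω)
    (hb : Bornology.IsBounded Ω) (hγ : IsSmoothJordanBoundary Ω γ) {f : ℂ → ℂ}
    (hf2 : ContDiffOn ℝ 2 f Ω) (hf1 : IsC1UpToBoundary Ω f) {z : ℂ} (hz : z ∈ Ω) :
    (∀ ε : ℝ, 0 < ε → IntegrableOn (domainIntegrand α β f z) (innerPart Ω ε)) ∧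
    Tendsto (fun ε : ℝ => boundaryPart α β Ω γ f z
        + (1 / Real.pi : ℂ) * ∫ ξ in innerPart Ω ε, domainIntegrand α β f z ξ)
      (𝓝[>] 0) (𝓝 (f z)) := by
  obtain ⟨hfC1, hfc, D, hDc, hD⟩ := hf1
  set u := extendFrom Ω (dz f) with hu
  set w := extendFrom Ω (dzbar (conjFun f)) with hw
  set s := extendFrom Ω (dzbar f)
  have hDa : ∀ v, ContinuousOn (fun p => D p v) (closure Ω) := fun v =>
    hDc.clm_apply continuousOn_const
  have hfcC : ContDiffOn ℝ 2 (conjFun f) Ω := contDiff_conj.comp_contDiffOn hf2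
  have huΩ : EqOn u (dz f) Ω := extendFrom_eqOn (contDiffOn_dz hΩ hf2).continuousOn
  have hwΩ : EqOn w (dzbar (conjFun f)) Ω :=
    extendFrom_eqOn (contDiffOn_dzbar hΩ hfcC).continuousOn
  have hsΩ : EqOn s (dzbar f) Ω := extendFrom_eqOn (contDiffOn_dzbar hΩ hf2).continuousOn
  have huD : ContDiffOn ℝ 1 u Ω := (contDiffOn_dz hΩ hf2).congr huΩ
  have hwD : ContDiffOn ℝ 1 w Ω := (contDiffOn_dzbar hΩ hfcC).congr hwΩ
  have hsD : ContDiffOn ℝ 1 s Ω := (contDiffOn_dzbar hΩ hf2).congr hsΩ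
  have hEz : ContinuousOn (fun p => (D p 1 - Complex.I * D p Complex.I) / 2) (closure Ω) :=
    ((hDa 1).sub (continuousOn_const.mul (hDa Complex.I))).div_const 2
  have hEzΩ : EqOn (fun p => (D p 1 - Complex.I * D p Complex.I) / 2) (dz f) Ω := fun p hp => by
    simp only [dz, hD hp]
  have huc : ContinuousOn u (closure Ω) := continuousOn_extendFrom_of_eqOn hEz hEzΩ
  have hwc : ContinuousOn w (closure Ω) :=
    continuousOn_extendFrom_of_eqOn (Complex.continuous_conj.comp_continuousOn hEz) fun p hp => by
      rw [dzbar_conjFun_eqOn hΩ hfC1 hp]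
      exact congrArg conj (hEzΩ hp)
  have hsc : ContinuousOn s (closure Ω) := continuousOn_extendFrom_of_eqOn
    (E := fun p => (D p 1 + Complex.I * D p Complex.I) / 2)
    (((hDa 1).add (continuousOn_const.mul (hDa Complex.I))).div_const 2) fun p hp => by
      simp only [dzbar, hD hp]
  have S₁ := satisfiesStokes_quotKernel_mul hΩ hb hγ hz
    (a := fun q => α * u q + β * w q)
    ((contDiffOn_const.mul huD).add (contDiffOn_const.mul hwD))
    ((continuousOn_const.mul huc).add (continuousOn_const.mul hwc))
  have S₂ := satisfiesStokes_logKernel_mul hΩ hb hγ hz (a := fun q => α * w q)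
    (contDiffOn_const.mul hwD) (continuousOn_const.mul hwc)
  have S₃ := satisfiesStokes_logKernel_mul hΩ hb hγ hz (a := fun q => β * s q)
    (contDiffOn_const.mul hsD) (continuousOn_const.mul hsc)
  obtain ⟨hi₄, hl₄⟩ := tendsto_integral_dz_div_conj hΩ hb hγ hz hfC1 hfc
  obtain ⟨hi₅, hl₅⟩ := tendsto_integral_dzbar_div hΩ hb hγ hz hfC1 hfc
  have hae : ∀ ε, _ =ᵐ[volume.restrict (innerPart Ω ε)] domainIntegrand α β f z := fun ε => by
    have hnez : ∀ᵐ p : ℂ ∂volume.restrict (innerPart Ω ε), p ≠ z :=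
      ae_restrict_of_ae (by simp [ae_iff])
    filter_upwards [hnez, ae_restrict_mem (isOpen_innerPart hΩ ε).measurableSet] with p hp hpε
    exact (domainIntegrand_eq hΩ hf2 hpε.1 hp α β huΩ hwΩ hsΩ).symm
  have hi₁₂ : ∀ ε, 0 < ε → IntegrableOn _ (innerPart Ω ε) := fun ε hε =>
    ((S₁.integrableOn_dz hε).const_mul (alphaStar α β : ℂ)).sub
      ((S₂.integrableOn_dzbar hε).const_mul (betaStar α β : ℂ))
  have hi₁₃ : ∀ ε, 0 < ε → IntegrableOn _ (innerPart Ω ε) := fun ε hε =>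
    (hi₁₂ ε hε).sub ((S₃.integrableOn_dz hε).const_mul (betaStar α β : ℂ))
  have hi₁₄ : ∀ ε, 0 < ε → IntegrableOn _ (innerPart Ω ε) := fun ε hε =>
    (hi₁₃ ε hε).sub ((hi₄ ε hε).const_mul (α * alphaStar α β : ℂ))
  have hi₁₅ : ∀ ε, 0 < ε → IntegrableOn _ (innerPart Ω ε) := fun ε hε =>
    (hi₁₄ ε hε).add ((hi₅ ε hε).const_mul (β * betaStar α β : ℂ))
  refine ⟨fun ε hε => (hi₁₅ ε hε).congr (hae ε), ?_⟩
  have hlim := ((((S₁.tendsto_dz hγ).const_mul (alphaStar α β : ℂ)).sub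
    ((S₂.tendsto_dzbar hγ).const_mul (betaStar α β : ℂ))).sub
    ((S₃.tendsto_dz hγ).const_mul (betaStar α β : ℂ))).sub
    (hl₄.const_mul (α * alphaStar α β : ℂ)) |>.add
    (hl₅.const_mul (β * betaStar α β : ℂ))
  have hlim2 := (hlim.const_mul (1 / Real.pi : ℂ)).const_add (boundaryPart α β Ω γ f z)
  have hstar : (α : ℂ) * alphaStar α β - β * betaStar α β = 1 := by
    have : α * alphaStar α β - β * betaStar α β = 1 := by
      rw [alphaStar, betaStar]; field_simp
    exact_mod_cast this
  have hpi : (Real.pi : ℂ) ≠ 0 := by exact_mod_cast Real.pi_ne_zero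
  have hlim3 := hlim2.congr' (f₂ := fun ε : ℝ => boundaryPart α β Ω γ f z
      + (1 / Real.pi : ℂ) * ∫ ξ in innerPart Ω ε, domainIntegrand α β f z ξ) (by
    filter_upwards [self_mem_nhdsWithin] with ε hε
    congr 2
    rw [← integral_congr_ae (hae ε)]
    have e₂ := integral_sub' ((S₁.integrableOn_dz hε).const_mul (alphaStar α β : ℂ))
      ((S₂.integrableOn_dzbar hε).const_mul (betaStar α β : ℂ))
    have e₃ := integral_sub' (hi₁₂ ε hε) ((S₃.integrableOn_dz hε).const_mul (betaStar α β : ℂ))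
    have e₄ := integral_sub' (hi₁₃ ε hε) ((hi₄ ε hε).const_mul (α * alphaStar α β : ℂ))
    have e₅ := integral_add' (hi₁₄ ε hε) ((hi₅ ε hε).const_mul (β * betaStar α β : ℂ))
    rw [e₄, e₃, e₂] at e₅
    simp only [integral_const_mul] at e₅
    exact e₅.symm)
  convert hlim3 using 2
  rw [boundaryPart, formIntegral_neg_eq_sub hγ S₂.continuousOn S₃.continuousOn]
  simp only [← hu, ← hw]
  generalize formIntegral γ (fun _ => 0) (fun ξ => f ξ / conj (ξ - z)) = F₁
  generalize formIntegral γ (fun ξ => f ξ / (ξ - z)) (fun _ => 0) = F₂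
  generalize formIntegral γ (fun _ => 0) (fun p => quotKernel z p * (α * u p + β * w p)) = F₃
  generalize formIntegral γ (fun p => logKernel z p * (α * w p)) (fun _ => 0) = F₄
  generalize formIntegral γ (fun _ => 0) (fun p => logKernel z p * (β * s p)) = F₅
  push_cast
  have hI := Complex.I_ne_zero
  field_simp
  linear_combination (-2 * f z * Complex.I * Real.pi) * hstar

end LameNavier

theorem theorem1 (lam mu α β : ℝ) (hmu : 0 < mu) (hlam : -(2 * mu / 3) < lam)
    (hα : α = (mu + lam) / 2) (hβ : β = (3 * mu + lam) / 2)
    (Ω : Set ℂ) (hΩ_open : IsOpen Ω) (hΩ_simply : IsSimplyConnected Ω)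
    (hΩ_bdd : Bornology.IsBounded Ω)
    (γ : ℝ → ℂ) (hγ : LameNavier.IsSmoothJordanBoundary Ω γ)
    (f : ℂ → ℂ) (hf2 : ContDiffOn ℝ 2 f Ω) (hf1 : LameNavier.IsC1UpToBoundary Ω f)
    (z : ℂ) (hz : z ∈ Ω) :
    (∀ ε : ℝ, 0 < ε →
      IntegrableOn (LameNavier.domainIntegrand α β f z) (LameNavier.innerPart Ω ε) volume) ∧
    Tendsto
      (fun ε : ℝ => LameNavier.boundaryPart α β Ω γ f z
        + (1 / Real.pi : ℂ) *
          ∫ ξ in LameNavier.innerPart Ω ε, LameNavier.domainIntegrand α β f z ξ)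
      (𝓝[>] 0) (𝓝 (f z)) ∧
    (IntegrableOn (LameNavier.domainIntegrand α β f z) Ω volume →
      f z = LameNavier.boundaryPart α β Ω γ f z
        + (1 / Real.pi : ℂ) * ∫ ξ in Ω, LameNavier.domainIntegrand α β f z ξ) := by
  have hαβ : α ^ 2 - β ^ 2 ≠ 0 := by
    have h1 : α ^ 2 - β ^ 2 = -(mu * (2 * mu + lam)) := by rw [hα, hβ]; ring
    have h2 : 0 < mu * (2 * mu + lam) := mul_pos hmu (by linarith)
    rw [h1]
    exact (neg_lt_zero.2 h2).ne
  obtain ⟨hi, hl⟩ := LameNavier.borelPompeiu hαβ hΩ_open hΩ_bdd hγ hf2 hf1 hz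
  refine ⟨hi, hl, fun hint => tendsto_nhds_unique hl ?_⟩
  exact ((LameNavier.tendsto_integral_innerPart hΩ_open ⟨_, hγ.mem_frontier 0⟩ hint).const_mul
    _).const_add _
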